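/- In the problem max $k$-dominating set, the input is a finite simple graph $G=(V,E)$ with $V=\{0,\dots,n-1\}$ and an integer $k\ge 0$; a feasible solution is a set $V'\subseteq V$ with exactly $k$ vertices, and its value, which is to be maximized, is the number of vertices of $V\setminus V'$ that have a neighbour in $V'$. Let $\Delta$ denote the maximum degree of $G$. Then max $k$-dominating set can be solved in time $O^*((\Delta k)^{2k})$, where $O^*$ ignores factors polynomial in $n$. Precisely: there are a single deterministic random access machine program and a polynomial $P$ with non-negative integer coefficients such that, for every $n\ge 0$, every graph $G$ on $n$ vertices (given by its adjacency matrix) and every $k\ge 0$, the program, started on $(n,k,G)$, halts after at most $$P(n)\cdot\max\bigl\{1,(\Delta k)^{2k}\bigr\}$$ steps; if $k\le n$ it outputs a feasible solution of maximum value together with that value, and if $k>n$ it reports that there is no feasible solution. Here $0^0=1$, and each elementary instruction (setting a register to a constant, copying a register, adding one, truncated subtraction, reading or writing an array cell at an index held in a register, doing nothing) and each test of whether a register is zero counts as one step. -/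

import Mathlib

/-! ### The random access machine

Programs act on finitely many registers and finitely many arrays of natural numbers.
The only instructions are constants, copying, successor, truncated subtraction and indexed
array access, so after `t` steps every stored number is at most `t` plus the largest number
in the input or in the program text; hence charging one unit per instruction hides no work on
long numbers. There is no multiplication and no addition in one step. -/

/-- A memory state: the contents of the registers and of the arrays. -/
structure RAMState where
  reg : ℕ → ℕ
  arr : ℕ → ℕ → ℕ

/-- `s.setReg r x` is `s` with the number `x` written into register `r`. -/
def RAMState.setReg (s : RAMState) (r x : ℕ) : RAMState :=
  { s with reg := Function.update s.reg r x }

/-- `s.setArr a i x` is `s` with the number `x` written into cell `i` of array `a`. -/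
def RAMState.setArr (s : RAMState) (a i x : ℕ) : RAMState :=
  { s with arr := Function.update s.arr a (Function.update (s.arr a) i x) }

/-- Structured programs. Here `r`, `r₁`, `r₂`, `i` name registers and `a` names an array. -/
inductive RAMProgram : Type
  /-- Do nothing. -/
  | skip : RAMProgram
  /-- `r := c` -/
  | const (r c : ℕ) : RAMProgram
  /-- `r := r₁` -/
  | copy (r r₁ : ℕ) : RAMProgram
  /-- `r := r + 1` -/
  | succ (r : ℕ) : RAMProgram
  /-- `r := r₁ - r₂` (truncated at zero) -/
  | sub (r r₁ r₂ : ℕ) : RAMProgram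
  /-- `r := a[i]`, the index being the content of register `i` -/
  | load (r a i : ℕ) : RAMProgram
  /-- `a[i] := r`, the index being the content of register `i` -/
  | store (a i r : ℕ) : RAMProgram
  /-- First `p`, then `q`. -/
  | seq (p q : RAMProgram) : RAMProgram
  /-- If `r ≠ 0` then `p` else `q`. -/
  | cond (r : ℕ) (p q : RAMProgram) : RAMProgram
  /-- While `r ≠ 0` do `p`. -/
  | loop (r : ℕ) (p : RAMProgram) : RAMProgram

/-- `RAMProgram.Runs p s t s'`: started in state `s`, the program `p` halts after exactly `t`
steps in state `s'`. Every instruction and every test of a condition counts as one step. -/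
inductive RAMProgram.Runs : RAMProgram → RAMState → ℕ → RAMState → Prop
  | skip (s : RAMState) : Runs .skip s 1 s
  | const (r c : ℕ) (s : RAMState) : Runs (.const r c) s 1 (s.setReg r c)
  | copy (r r₁ : ℕ) (s : RAMState) : Runs (.copy r r₁) s 1 (s.setReg r (s.reg r₁))
  | succ (r : ℕ) (s : RAMState) : Runs (.succ r) s 1 (s.setReg r (s.reg r + 1))
  | sub (r r₁ r₂ : ℕ) (s : RAMState) :
      Runs (.sub r r₁ r₂) s 1 (s.setReg r (s.reg r₁ - s.reg r₂))
  | load (r a i : ℕ) (s : RAMState) :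
      Runs (.load r a i) s 1 (s.setReg r (s.arr a (s.reg i)))
  | store (a i r : ℕ) (s : RAMState) :
      Runs (.store a i r) s 1 (s.setArr a (s.reg i) (s.reg r))
  | seq {p q : RAMProgram} {s₁ s₂ s₃ : RAMState} {t₁ t₂ : ℕ} :
      Runs p s₁ t₁ s₂ → Runs q s₂ t₂ s₃ → Runs (.seq p q) s₁ (t₁ + t₂) s₃
  | cond_true {r : ℕ} {p q : RAMProgram} {s s₁ : RAMState} {t : ℕ} :
      s.reg r ≠ 0 → Runs p s t s₁ → Runs (.cond r p q) s (1 + t) s₁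
  | cond_false {r : ℕ} {p q : RAMProgram} {s s₁ : RAMState} {t : ℕ} :
      s.reg r = 0 → Runs q s t s₁ → Runs (.cond r p q) s (1 + t) s₁
  | loop_done {r : ℕ} {p : RAMProgram} {s : RAMState} :
      s.reg r = 0 → Runs (.loop r p) s 1 s
  | loop_step {r : ℕ} {p : RAMProgram} {s₁ s₂ s₃ : RAMState} {t₁ t₂ : ℕ} :
      s₁.reg r ≠ 0 → Runs p s₁ t₁ s₂ → Runs (.loop r p) s₂ t₂ s₃ →
      Runs (.loop r p) s₁ (1 + t₁ + t₂) s₃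

/-! ### The problem: maximum `k`-dominating set -/

open Classical in
/-- The number of vertices outside `S` that have a neighbour in `S`. -/
noncomputable def dominatedCount {V : Type*} [Fintype V] (G : SimpleGraph V)
    (S : Finset V) : ℕ :=
  (Finset.univ.filter fun v => v ∉ S ∧ ∃ u ∈ S, G.Adj u v).card

/-- `S` has exactly `k` vertices and, among all such sets, dominates the largest number of
vertices outside itself. -/
def IsMaxKDominating {V : Type*} [Fintype V] (G : SimpleGraph V) (k : ℕ)
    (S : Finset V) : Prop :=
  S.card = k ∧ ∀ S' : Finset V, S'.card = k → dominatedCount G S' ≤ dominatedCount G S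

open Classical in
/-- The input: `n` in register `0`, `k` in register `1`, the adjacency matrix of `G`, row by
row, in the cells `0, …, n * n - 1` of array `0`, and zeros everywhere else. -/
noncomputable def maxKDominatingInput {n : ℕ} (G : SimpleGraph (Fin n)) (k : ℕ) : RAMState where
  reg := fun r => if r = 0 then n else if r = 1 then k else 0
  arr := fun a i =>
    if a = 0 ∧ ∃ u v : Fin n, G.Adj u v ∧ i = (u : ℕ) * n + (v : ℕ) then 1 else 0

open Classical in
/-- The required output. If there is no set of `k` vertices, register `0` contains `0`.
Otherwise register `0` contains `1`, the cells `0, …, n - 1` of array `1` contain the indicator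
vector of an optimal solution, and register `1` contains its value. -/
def MaxKDominatingOutput {n : ℕ} (G : SimpleGraph (Fin n)) (k : ℕ) (s : RAMState) : Prop :=
  (n < k ∧ s.reg 0 = 0) ∨
  (k ≤ n ∧ s.reg 0 = 1 ∧ ∃ S : Finset (Fin n), IsMaxKDominating G k S ∧
    (∀ v : Fin n, s.arr 1 (v : ℕ) = if v ∈ S then 1 else 0) ∧
    s.reg 1 = dominatedCount G S)

/-! A set of `k` vertices dominates `|cover S| - k` vertices outside itself, where `cover S` is the
union of the closed neighbourhoods of its members, so it suffices to maximize coverage. Let `T` lie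
in an optimal `S`, with `|T| < k`, and let `v` outside `T` cover the most vertices that `T` leaves
uncovered. Then some optimal solution contains `T` and one more vertex whose closed neighbourhood
meets that of `v`. Indeed, if `S \ T` has no such vertex, it takes nothing away from the gain of `v`
over `T`, and exchanging any member of `S \ T` for `v` loses nothing
(`SimpleGraph.exists_optimal_insert`).

At most `Δ² + 1` vertices are that near to `v` (`SimpleGraph.card_nearby_le`). Hence a search tree
of depth `k` with `D ≤ Δ² + 1` branches at each node has an optimal leaf
(`exists_branchSolution_optimal`), and it has at most `(Δ² + 1)^k ≤ 2 * max 1 ((Δk)^(2k))` leaves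
(`sq_add_one_pow_le`).

The machine has no recursion, so the leaves are enumerated by a counter with `k` digits in base `D`.
Each round rebuilds one leaf from its digits, compares it with the best one so far and increments
the counter. A digit that names no usable vertex falls back on the greedy vertex, so every digit
string yields exactly `k` vertices. `Mem.Invariant` says that after `j` rounds all strings of value
below `j` have been taken into account.

That a round takes polynomial time is proved by closure properties: `Comp` (expressions), `CompPred`
(predicates) and `Cmd` (memory updates) are closed under branching, binding and loops of length `n`,
as appropriate. Only the outermost loop, of `D^k` rounds, is treated by hand. -/

/-! ### Bounded loops and indicators -/

/-- `x` after the steps `h 0, …, h (n - 1)`. -/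
def loopN {β : Type*} (h : ℕ → β → β) (x : β) : ℕ → β
  | 0 => x
  | n + 1 => h n (loopN h x n)

open Classical in
/-- The truth value of `p` as a number. -/
noncomputable def ind (p : Prop) : ℕ := if p then 1 else 0

/-- The number of `i < n` with `p i`. -/
noncomputable def countBelow (n : ℕ) (p : ℕ → Prop) : ℕ :=
  loopN (fun i x => x + ind (p i)) 0 n

/-- The least `i < n` with `p i`, or `n` if there is none. -/
noncomputable def firstBelow (n : ℕ) (p : ℕ → Prop) : ℕ :=
  countBelow n fun j => ¬ ∃ i < n, i ≤ j ∧ p i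

theorem ind_of {p : Prop} (h : p) : ind p = 1 := by simp [ind, h]

theorem ind_of_not {p : Prop} (h : ¬p) : ind p = 0 := by simp [ind, h]

theorem ind_eq_zero {p : Prop} : ind p = 0 ↔ ¬p := by simp [ind]

theorem countBelow_eq_card (n : ℕ) (p : ℕ → Prop) [DecidablePred p] :
    countBelow n p = ((Finset.range n).filter p).card := by
  unfold countBelow
  induction n with
  | zero => simp [loopN]
  | succ n ih =>
    rw [loopN, ih, Finset.range_add_one, Finset.filter_insert]
    by_cases h : p n
    · simp [h, ind]
    · simp [h, ind]

theorem countBelow_pos {n : ℕ} {p : ℕ → Prop} : 0 < countBelow n p ↔ ∃ i < n, p i := by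
  classical
  rw [countBelow_eq_card, Finset.card_pos]
  simp [Finset.Nonempty]

theorem firstBelow_le (n : ℕ) (p : ℕ → Prop) : firstBelow n p ≤ n := by
  classical
  rw [firstBelow, countBelow_eq_card]
  simpa using Finset.card_filter_le (Finset.range n) _

/-- The indices counted by `firstBelow` are those with no witness at or below them, which are
exactly the indices below the first witness. -/
theorem firstBelow_of_first {n i : ℕ} {p : ℕ → Prop} (hi : i < n) (hp : p i)
    (hmin : ∀ j < i, ¬p j) : firstBelow n p = i := by
  classical
  rw [firstBelow, countBelow_eq_card]
  have : (Finset.range n).filter (fun j => ¬ ∃ i < n, i ≤ j ∧ p i) = Finset.range i := by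
    ext j
    simp only [Finset.mem_filter, Finset.mem_range]
    constructor
    · rintro ⟨hj, h⟩
      by_contra hji
      exact h ⟨i, hi, by omega, hp⟩
    · intro hj
      refine ⟨by omega, ?_⟩
      rintro ⟨l, hl, hlj, hpl⟩
      exact hmin l (by omega) hpl
  rw [this, Finset.card_range]

theorem firstBelow_spec {n : ℕ} {p : ℕ → Prop} (h : ∃ i < n, p i) :
    firstBelow n p < n ∧ p (firstBelow n p) ∧ ∀ j < firstBelow n p, ¬p j := by
  classical
  obtain ⟨h₁, h₂⟩ := Nat.find_spec h
  have : firstBelow n p = Nat.find h :=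
    firstBelow_of_first h₁ h₂ fun j hj hpj => Nat.find_min h hj ⟨by omega, hpj⟩
  rw [this]
  exact ⟨h₁, h₂, fun j hj hpj => Nat.find_min h hj ⟨by omega, hpj⟩⟩

theorem firstBelow_of_forall_not {n : ℕ} {p : ℕ → Prop} (h : ∀ i < n, ¬p i) :
    firstBelow n p = n := by
  classical
  rw [firstBelow, countBelow_eq_card, Finset.filter_true_of_mem, Finset.card_range]
  rintro j - ⟨i, hi, -, hp⟩
  exact h i hi hp

/-! ### Programs that evaluate expressions -/

@[simp] theorem RAMState.setReg_arr (s : RAMState) (r x : ℕ) : (s.setReg r x).arr = s.arr := rfl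

@[simp] theorem RAMState.setReg_reg_self (s : RAMState) (r x : ℕ) :
    (s.setReg r x).reg r = x := by simp [RAMState.setReg]

theorem RAMState.setReg_reg_of_ne (s : RAMState) {r r' : ℕ} (x : ℕ) (h : r' ≠ r) :
    (s.setReg r x).reg r' = s.reg r' := by simp [RAMState.setReg, h]

/-- A loop whose invariant `I` counts the iterations and determines when it stops. -/
theorem RAMProgram.Runs.loop_of_invariant {r : ℕ} {p : RAMProgram} {b N : ℕ}
    {I : ℕ → RAMState → Prop} (hI : ∀ j s, j ≤ N → I j s → (s.reg r = 0 ↔ j = N))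
    (step : ∀ j < N, ∀ s, I j s → ∃ t s', p.Runs s t s' ∧ t ≤ b ∧ I (j + 1) s')
    {s : RAMState} (hs : I 0 s) :
    ∃ t s', (RAMProgram.loop r p).Runs s t s' ∧ t ≤ N * (b + 1) + 1 ∧ I N s' := by
  suffices H : ∀ d j s, j + d = N → I j s →
      ∃ t s', (RAMProgram.loop r p).Runs s t s' ∧ t ≤ d * (b + 1) + 1 ∧ I N s' from
    H N 0 s (by omega) hs
  intro d
  induction d with
  | zero =>
    intro j s hj h
    obtain rfl : j = N := by omega
    exact ⟨1, s, .loop_done ((hI j s le_rfl h).2 rfl), by omega, h⟩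
  | succ d ih =>
    intro j s hj h
    obtain ⟨t₁, s₁, hr₁, ht₁, h₁⟩ := step j (by omega) s h
    obtain ⟨t₂, s₂, hr₂, ht₂, h₂⟩ := ih (j + 1) s₁ (by omega) h₁
    refine ⟨1 + t₁ + t₂, s₂, .loop_step (fun h0 => ?_) hr₁ hr₂, ?_, h₂⟩
    · have := (hI j s (by omega) h).1 h0
      omega
    · rw [add_mul]; omega

/-- How values of type `α` are held in memory: a value occupies registers below `lvl` and
arrays, and its size is in register `0`. -/
structure Ctx (α : Type) where
  lvl : ℕ
  size : α → ℕ
  Holds : α → RAMState → Prop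
  pos : 0 < lvl
  reg_zero : ∀ {a s}, Holds a s → s.reg 0 = size a
  congr : ∀ {a s s'}, Holds a s → s'.arr = s.arr → (∀ r < lvl, s'.reg r = s.reg r) → Holds a s'

/-- The context `c` with one more number, in the register `max c.lvl m`. -/
def Ctx.ext {α : Type} (c : Ctx α) (m : ℕ) : Ctx (α × ℕ) where
  lvl := max c.lvl m + 1
  size x := c.size x.1
  Holds x s := c.Holds x.1 s ∧ s.reg (max c.lvl m) = x.2
  pos := by omega
  reg_zero h := c.reg_zero h.1
  congr h ha hr :=
    ⟨c.congr h.1 ha fun r h' => hr r (by omega), (hr _ (by omega)).trans h.2⟩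

/-- `p` evaluates `f` into register `m` within `P` steps, keeping the arrays and the registers
below `m`. -/
def Ctx.Evaluates {α : Type} (c : Ctx α) (m : ℕ) (p : RAMProgram) (P : Polynomial ℕ)
    (f : α → ℕ) : Prop :=
  ∀ a s, c.Holds a s → ∃ t s', p.Runs s t s' ∧ t ≤ P.eval (c.size a) ∧ s'.arr = s.arr ∧
    (∀ r < m, s'.reg r = s.reg r) ∧ s'.reg m = f a

/-- `f` can be evaluated in polynomial time. -/
def Comp {α : Type} (c : Ctx α) (f : α → ℕ) : Prop :=
  ∀ m, c.lvl ≤ m → ∃ p P, c.Evaluates m p P f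

/-- `q` can be decided in polynomial time. -/
def CompPred {α : Type} (c : Ctx α) (q : α → Prop) : Prop :=
  Comp c fun a => ind (q a)

namespace Comp

variable {α : Type} {c : Ctx α} {f g : α → ℕ}

theorem of_reg (r : ℕ) (h : ∀ a s, c.Holds a s → s.reg r = f a) : Comp c f := fun m _ =>
  ⟨.copy m r, 1, fun a s hs => ⟨1, _, .copy m r s, by simp, rfl,
    fun r' hr => s.setReg_reg_of_ne _ (by omega), by simp [h a s hs]⟩⟩

theorem size (c : Ctx α) : Comp c c.size := of_reg 0 fun _ _ h => c.reg_zero h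

theorem weaken (hf : Comp c f) (m : ℕ) : Comp (c.ext m) fun x => f x.1 := fun m' hm => by
  have hm : max c.lvl m + 1 ≤ m' := hm
  obtain ⟨p, P, h⟩ := hf m' (by omega)
  exact ⟨p, P, fun a s hs => h a.1 s hs.1⟩

theorem last (c : Ctx α) (m : ℕ) : Comp (c.ext m) fun x => x.2 :=
  of_reg (max c.lvl m) fun _ _ h => h.2

/-- Lets an expression in one extra variable ignore a second one stored between the context and it.
This is why closure hypotheses quantify over every `m`: the variable may sit in any register above
the context. -/
theorem insert {h : α → ℕ → ℕ} (hh : ∀ m, Comp (c.ext m) fun x => h x.1 x.2) (m m' : ℕ) :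
    Comp ((c.ext m).ext m') fun x => h x.1.1 x.2 := fun l hl => by
  have hl' : max (max c.lvl m + 1) m' + 1 ≤ l := hl
  obtain ⟨p, P, H⟩ := hh (max (max c.lvl m + 1) m') l (by simp only [Ctx.ext]; omega)
  refine ⟨p, P, fun a s hs => H (a.1.1, a.2) s ⟨hs.1.1, ?_⟩⟩
  rw [← hs.2]
  change s.reg (max c.lvl (max (max c.lvl m + 1) m')) = s.reg (max (max c.lvl m + 1) m')
  congr 1
  omega

theorem const (c : Ctx α) (x : ℕ) : Comp c fun _ => x := fun m _ =>
  ⟨.const m x, 1, fun _ s _ => ⟨1, _, .const m x s, by simp, rfl,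
    fun _ hr => s.setReg_reg_of_ne _ (by omega), by simp⟩⟩

theorem succ (hf : Comp c f) : Comp c fun a => f a + 1 := fun m hm => by
  obtain ⟨p, P, h⟩ := hf m hm
  refine ⟨.seq p (.succ m), P + 1, fun a s hs => ?_⟩
  obtain ⟨t, s', hr, ht, ha, hl, hv⟩ := h a s hs
  refine ⟨t + 1, _, .seq hr (.succ m s'), by simpa using ht, ha, fun r hr' => ?_, by simp [hv]⟩
  rw [s'.setReg_reg_of_ne _ (by omega), hl r hr']

theorem sub (hf : Comp c f) (hg : Comp c g) : Comp c fun a => f a - g a := fun m hm => by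
  obtain ⟨p, P, h⟩ := hf m hm
  obtain ⟨q, Q, h'⟩ := hg (m + 1) (by omega)
  refine ⟨.seq p (.seq q (.sub m m (m + 1))), P + (Q + 1), fun a s hs => ?_⟩
  obtain ⟨t, s₁, hr, ht, ha, hl, hv⟩ := h a s hs
  obtain ⟨t', s₂, hr', ht', ha', hl', hv'⟩ :=
    h' a s₁ (c.congr hs ha fun r h => hl r (by omega))
  refine ⟨t + (t' + 1), _, .seq hr (.seq hr' (.sub _ _ _ s₂)), ?_, ha'.trans ha,
    fun r h => ?_, ?_⟩
  · simp only [Polynomial.eval_add, Polynomial.eval_one]; omega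
  · rw [s₂.setReg_reg_of_ne _ (by omega), hl' r (by omega), hl r h]
  · rw [s₂.setReg_reg_self, hl' m (by omega), hv, hv']

theorem load (i : ℕ) {F : α → ℕ → ℕ} (hF : ∀ a s, c.Holds a s → s.arr i = F a)
    (hf : Comp c f) : Comp c fun a => F a (f a) := fun m hm => by
  obtain ⟨p, P, h⟩ := hf m hm
  refine ⟨.seq p (.load m i m), P + 1, fun a s hs => ?_⟩
  obtain ⟨t, s', hr, ht, ha, hl, hv⟩ := h a s hs
  refine ⟨t + 1, _, .seq hr (.load _ _ _ s'), by simpa using ht, ha, fun r hr' => ?_,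
    by simp [hv, ha, hF a s hs]⟩
  rw [s'.setReg_reg_of_ne _ (by omega), hl r hr']

theorem ite {q : α → Prop} [∀ a, Decidable (q a)] (hq : CompPred c q) (hf : Comp c f)
    (hg : Comp c g) : Comp c fun a => if q a then f a else g a := fun m hm => by
  obtain ⟨p, P, h⟩ := hq m hm
  obtain ⟨p₁, P₁, h₁⟩ := hf m hm
  obtain ⟨p₂, P₂, h₂⟩ := hg m hm
  refine ⟨.seq p (.cond m p₁ p₂), P + (1 + P₁ + P₂), fun a s hs => ?_⟩
  obtain ⟨t, s₁, hr, ht, ha, hl, hv⟩ := h a s hs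
  have hs₁ := c.congr hs ha fun r h => hl r (by omega)
  simp only [Polynomial.eval_add, Polynomial.eval_one]
  by_cases hqa : q a
  · obtain ⟨t', s₂, hr', ht', ha', hl', hv'⟩ := h₁ a s₁ hs₁
    refine ⟨_, s₂, .seq hr (.cond_true (by simp [hv, ind_of hqa]) hr'), by omega,
      ha'.trans ha, fun r h => (hl' r h).trans (hl r h), by simp [hv', hqa]⟩
  · obtain ⟨t', s₂, hr', ht', ha', hl', hv'⟩ := h₂ a s₁ hs₁
    refine ⟨_, s₂, .seq hr (.cond_false (by simp [hv, ind_of_not hqa]) hr'), by omega,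
      ha'.trans ha, fun r h => (hl' r h).trans (hl r h), by simp [hv', hqa]⟩

theorem bind {h : α → ℕ → ℕ} (hf : Comp c f)
    (hh : ∀ m, Comp (c.ext m) fun x => h x.1 x.2) : Comp c fun a => h a (f a) := fun m hm => by
  obtain ⟨p, P, H⟩ := hf m hm
  have hmax : max c.lvl m = m := by omega
  obtain ⟨q, Q, H'⟩ := hh m (m + 1) (by simp [Ctx.ext, hmax])
  refine ⟨.seq p (.seq q (.copy m (m + 1))), P + (Q + 1), fun a s hs => ?_⟩
  obtain ⟨t, s₁, hr, ht, ha, hl, hv⟩ := H a s hs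
  obtain ⟨t', s₂, hr', ht', ha', hl', hv'⟩ :=
    H' (a, f a) s₁ ⟨c.congr hs ha fun r h => hl r (by omega), by rw [hmax, hv]⟩
  have hsz : (c.ext m).size (a, f a) = c.size a := rfl
  rw [hsz] at ht'
  refine ⟨t + (t' + 1), _, .seq hr (.seq hr' (.copy _ _ s₂)), ?_, ha'.trans ha,
    fun r h => ?_, ?_⟩
  · simp only [Polynomial.eval_add, Polynomial.eval_one]; omega
  · rw [s₂.setReg_reg_of_ne _ (by omega), hl' r (by omega), hl r h]
  · rw [s₂.setReg_reg_self, hv']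

theorem loop {h : α → ℕ → ℕ → ℕ} (hf : Comp c f)
    (hh : ∀ m m', Comp ((c.ext m).ext m') fun x => h x.1.1 x.2 x.1.2) :
    Comp c fun a => loopN (h a) (f a) (c.size a) := fun m hm => by
  obtain ⟨p, P, H⟩ := hf m hm
  have hmax : max c.lvl m = m := by omega
  have hmax' : max (max c.lvl m + 1) (m + 1) = m + 1 := by omega
  -- Register `m` holds the accumulator, `m + 1` the index and `m + 2` the number of remaining
  -- iterations; the body is evaluated into `m + 3`.
  obtain ⟨q, Q, H'⟩ := hh m (m + 1) (m + 3) (by simp [Ctx.ext, hmax])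
  refine ⟨.seq p (.seq (.const (m + 1) 0) (.seq (.copy (m + 2) 0)
    (.loop (m + 2) (.seq q (.seq (.copy m (m + 3))
      (.seq (.succ (m + 1)) (.sub (m + 2) 0 (m + 1)))))))),
    P + (1 + (1 + (Polynomial.X * (Q + 4) + 1))), fun a s hs => ?_⟩
  obtain ⟨t, s₁, hr, ht, ha, hl, hv⟩ := H a s hs
  have hs₁ : c.Holds a s₁ := c.congr hs ha fun r h => hl r (by omega)
  have hpos := c.pos
  have h0 := c.reg_zero hs
  obtain ⟨t', s', hr', ht', ha', hl', hv', -, -⟩ := RAMProgram.Runs.loop_of_invariant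
    (r := m + 2) (p := .seq q (.seq (.copy m (m + 3))
      (.seq (.succ (m + 1)) (.sub (m + 2) 0 (m + 1))))) (N := c.size a)
    (b := Q.eval (c.size a) + 3)
    (I := fun j s' => s'.arr = s.arr ∧ (∀ r < m, s'.reg r = s.reg r) ∧
      s'.reg m = loopN (h a) (f a) j ∧ s'.reg (m + 1) = j ∧ s'.reg (m + 2) = c.size a - j)
    (fun j s' hj h => by rw [h.2.2.2.2]; omega)
    (by
      rintro j hj s' ⟨i₁, i₂, i₃, i₄, i₅⟩
      obtain ⟨t', s₂, hr', ht', ha', hl', hv'⟩ := H' ((a, loopN (h a) (f a) j), j) s'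
        ⟨⟨c.congr hs i₁ fun r h => i₂ r (by omega), by rw [hmax, i₃]⟩, by
          change s'.reg (max (max c.lvl m + 1) (m + 1)) = j
          rw [hmax', i₄]⟩
      refine ⟨_, _, .seq hr' (.seq (.copy _ _ _) (.seq (.succ _ _) (.sub _ _ _ _))), ?_, ?_⟩
      · have : t' ≤ Q.eval (c.size a) := ht'
        omega
      · refine ⟨ha'.trans i₁, fun r hr => ?_, ?_, ?_, ?_⟩
        · rw [RAMState.setReg_reg_of_ne _ _ (by omega), RAMState.setReg_reg_of_ne _ _ (by omega),
            RAMState.setReg_reg_of_ne _ _ (by omega), hl' r (by omega), i₂ r hr]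
        · rw [RAMState.setReg_reg_of_ne _ _ (by omega), RAMState.setReg_reg_of_ne _ _ (by omega),
            RAMState.setReg_reg_self, hv']
          rfl
        · rw [RAMState.setReg_reg_of_ne _ _ (by omega), RAMState.setReg_reg_self,
            RAMState.setReg_reg_of_ne _ _ (by omega), hl' _ (by omega), i₄]
        · rw [RAMState.setReg_reg_self, RAMState.setReg_reg_of_ne _ _ (by omega),
            RAMState.setReg_reg_of_ne _ _ (by omega), RAMState.setReg_reg_self,
            RAMState.setReg_reg_of_ne _ _ (by omega), hl' _ (by omega), hl' _ (by omega), i₄,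
            i₂ 0 (by omega), h0])
    (s := (s₁.setReg (m + 1) 0).setReg (m + 2) ((s₁.setReg (m + 1) 0).reg 0))
    ⟨ha, fun r hr => by
        rw [RAMState.setReg_reg_of_ne _ _ (by omega), RAMState.setReg_reg_of_ne _ _ (by omega),
          hl r hr],
      by rw [RAMState.setReg_reg_of_ne _ _ (by omega), RAMState.setReg_reg_of_ne _ _ (by omega),
          hv]; rfl,
      by rw [RAMState.setReg_reg_of_ne _ _ (by omega), RAMState.setReg_reg_self],
      by rw [RAMState.setReg_reg_self, RAMState.setReg_reg_of_ne _ _ (by omega),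
          hl 0 (by omega), h0]; rfl⟩
  refine ⟨_, s', .seq hr (.seq (.const _ _ _) (.seq (.copy _ _ _) hr')), ?_, ha', hl', hv'⟩
  simp only [Polynomial.eval_add, Polynomial.eval_one, Polynomial.eval_mul, Polynomial.eval_X,
    Polynomial.eval_ofNat]
  have : c.size a * (Q.eval (c.size a) + 3 + 1) = c.size a * (Q.eval (c.size a) + 4) := rfl
  omega

end Comp

/-! ### Predicates: connectives, counting, bounded quantifiers and search -/

namespace CompPred

variable {α : Type} {c : Ctx α} {f g : α → ℕ} {p q : α → Prop}

theorem congr (hp : CompPred c p) (h : ∀ a, q a ↔ p a) : CompPred c q := by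
  have : q = p := funext fun a => propext (h a)
  rwa [this]

protected theorem lt (hf : Comp c f) (hg : Comp c g) : CompPred c fun a => f a < g a := by
  have : (fun a => ind (f a < g a)) = fun a => 1 - (1 - (g a - f a)) := by
    funext a
    by_cases h : f a < g a
    · rw [ind_of h]; omega
    · rw [ind_of_not h]; omega
  unfold CompPred
  rw [this]
  exact (Comp.const c 1).sub ((Comp.const c 1).sub (hg.sub hf))

protected theorem not (hp : CompPred c p) : CompPred c fun a => ¬p a := by
  have : (fun a => ind (¬p a)) = fun a => 1 - ind (p a) := by
    funext a
    by_cases h : p a <;> simp [ind, h]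
  unfold CompPred
  rw [this]
  exact (Comp.const c 1).sub hp

protected theorem and (hp : CompPred c p) (hq : CompPred c q) :
    CompPred c fun a => p a ∧ q a := by
  -- Conjunction is expressed by truncated subtraction, the only binary arithmetic available.
  have : (fun a => ind (p a ∧ q a)) = fun a => ind (p a) - ind (¬q a) := by
    funext a
    by_cases h : p a <;> by_cases h' : q a <;> simp [ind, h, h']
  unfold CompPred
  rw [this]
  exact Comp.sub hp hq.not

protected theorem or (hp : CompPred c p) (hq : CompPred c q) :
    CompPred c fun a => p a ∨ q a :=
  (hp.not.and hq.not).not.congr fun a => by tauto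

protected theorem imp (hp : CompPred c p) (hq : CompPred c q) :
    CompPred c fun a => p a → q a :=
  (hp.and hq.not).not.congr fun a => by tauto

protected theorem le (hf : Comp c f) (hg : Comp c g) : CompPred c fun a => f a ≤ g a :=
  (CompPred.lt hg hf).not.congr fun a => by omega

protected theorem eq (hf : Comp c f) (hg : Comp c g) : CompPred c fun a => f a = g a :=
  ((CompPred.le hf hg).and (CompPred.le hg hf)).congr fun a => by omega

protected theorem count {r : α → ℕ → Prop}
    (hr : ∀ m, CompPred (c.ext m) fun x => r x.1 x.2) :
    Comp c fun a => countBelow (c.size a) (r a) := by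
  classical
  -- There is no addition instruction, so adding an indicator becomes a branch with a successor.
  have : (fun a => countBelow (c.size a) (r a)) =
      fun a => loopN (fun i x => if r a i then x + 1 else x) 0 (c.size a) := by
    funext a
    unfold countBelow
    congr 1
    funext i x
    by_cases h : r a i <;> simp [ind, h]
  rw [this]
  refine (Comp.const c 0).loop (h := fun a i x => if r a i then x + 1 else x) fun m m' => ?_
  have hx : Comp ((c.ext m).ext m') fun x => x.1.2 := (Comp.last c m).weaken m'
  exact Comp.ite (Comp.insert (h := fun a i => ind (r a i)) hr m m') hx.succ hx

theorem exists_lt {r : α → ℕ → Prop}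
    (hr : ∀ m, CompPred (c.ext m) fun x => r x.1 x.2) :
    CompPred c fun a => ∃ i < c.size a, r a i :=
  (CompPred.lt (Comp.const c 0) (CompPred.count hr)).congr fun _ => countBelow_pos.symm

theorem forall_lt {r : α → ℕ → Prop}
    (hr : ∀ m, CompPred (c.ext m) fun x => r x.1 x.2) :
    CompPred c fun a => ∀ i < c.size a, r a i :=
  (CompPred.exists_lt (r := fun a i => ¬r a i) fun m => (hr m).not).not.congr fun a => by
    push Not; rfl

/-- The least witness is defined as a count, so no loop with early exit is needed; the price is only
a polynomial factor. -/
protected theorem first {r : α → ℕ → Prop}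
    (hr : ∀ m, CompPred (c.ext m) fun x => r x.1 x.2) :
    Comp c fun a => firstBelow (c.size a) (r a) := by
  refine CompPred.count (r := fun a j => ¬ ∃ i < c.size a, i ≤ j ∧ r a i) fun m => ?_
  refine (CompPred.exists_lt (c := c.ext m) (r := fun x i => i ≤ x.2 ∧ r x.1 i) fun m' => ?_).not
  refine (CompPred.le (Comp.last _ _) ((Comp.last c m).weaken m')).and
    (Comp.insert (h := fun a i => ind (r a i)) hr m m')

end CompPred

/-! ### Programs that transform memory -/

/-- `F` can be carried out in memory in polynomial time. -/
def Cmd {α : Type} (c : Ctx α) (F : α → α) : Prop :=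
  ∃ (p : RAMProgram) (P : Polynomial ℕ), ∀ a s, c.Holds a s → ∃ t s', p.Runs s t s' ∧
    t ≤ P.eval (c.size a) ∧ c.Holds (F a) s' ∧ c.size (F a) = c.size a

namespace Cmd

variable {α : Type} {c : Ctx α} {f g : α → ℕ} {F G : α → α}

protected theorem id (c : Ctx α) : Cmd c fun a => a :=
  ⟨.skip, 1, fun a s hs => ⟨1, s, .skip s, by simp, hs, rfl⟩⟩

/-- Commands preserve the size, so both time bounds are evaluated at the same number and simply add.
-/
theorem seq (hF : Cmd c F) (hG : Cmd c G) : Cmd c fun a => G (F a) := by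
  obtain ⟨p, P, h⟩ := hF
  obtain ⟨q, Q, h'⟩ := hG
  refine ⟨.seq p q, P + Q, fun a s hs => ?_⟩
  obtain ⟨t, s₁, hr, ht, hs₁, hz⟩ := h a s hs
  obtain ⟨t', s₂, hr', ht', hs₂, hz'⟩ := h' (F a) s₁ hs₁
  rw [hz] at ht' hz'
  exact ⟨_, s₂, .seq hr hr', by rw [Polynomial.eval_add]; omega, hs₂, hz'⟩

theorem ite {q : α → Prop} [∀ a, Decidable (q a)] (hq : CompPred c q) (hF : Cmd c F)
    (hG : Cmd c G) : Cmd c fun a => if q a then F a else G a := by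
  obtain ⟨p, P, h⟩ := hq c.lvl le_rfl
  obtain ⟨p₁, P₁, h₁⟩ := hF
  obtain ⟨p₂, P₂, h₂⟩ := hG
  refine ⟨.seq p (.cond c.lvl p₁ p₂), P + (1 + P₁ + P₂), fun a s hs => ?_⟩
  obtain ⟨t, s₁, hr, ht, ha, hl, hv⟩ := h a s hs
  have hs₁ := c.congr hs ha hl
  simp only [Polynomial.eval_add, Polynomial.eval_one]
  by_cases hqa : q a
  · obtain ⟨t', s₂, hr', ht', hs₂, hz⟩ := h₁ a s₁ hs₁
    exact ⟨_, s₂, .seq hr (.cond_true (by simp [hv, ind_of hqa]) hr'), by omega,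
      by simpa [hqa] using hs₂, by simpa [hqa] using hz⟩
  · obtain ⟨t', s₂, hr', ht', hs₂, hz⟩ := h₂ a s₁ hs₁
    exact ⟨_, s₂, .seq hr (.cond_false (by simp [hv, ind_of_not hqa]) hr'), by omega,
      by simpa [hqa] using hs₂, by simpa [hqa] using hz⟩

theorem set (r : ℕ) (hf : Comp c f)
    (h : ∀ a s, c.Holds a s → c.Holds (F a) (s.setReg r (f a)))
    (hz : ∀ a, c.size (F a) = c.size a) : Cmd c F := by
  obtain ⟨p, P, H⟩ := hf c.lvl le_rfl
  refine ⟨.seq p (.copy r c.lvl), P + 1, fun a s hs => ?_⟩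
  obtain ⟨t, s₁, hr, ht, ha, hl, hv⟩ := H a s hs
  refine ⟨_, _, .seq hr (.copy _ _ s₁), by simpa using ht, ?_, hz a⟩
  rw [hv]
  exact h a s₁ (c.congr hs ha hl)

theorem store (i : ℕ) (hf : Comp c f) (hg : Comp c g)
    (h : ∀ a s, c.Holds a s → c.Holds (F a) (s.setArr i (f a) (g a)))
    (hz : ∀ a, c.size (F a) = c.size a) : Cmd c F := by
  obtain ⟨p, P, H⟩ := hf c.lvl le_rfl
  obtain ⟨q, Q, H'⟩ := hg (c.lvl + 1) (by omega)
  refine ⟨.seq p (.seq q (.store i c.lvl (c.lvl + 1))), P + (Q + 1), fun a s hs => ?_⟩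
  obtain ⟨t, s₁, hr, ht, ha, hl, hv⟩ := H a s hs
  have hs₁ := c.congr hs ha hl
  obtain ⟨t', s₂, hr', ht', ha', hl', hv'⟩ := H' a s₁ hs₁
  refine ⟨_, _, .seq hr (.seq hr' (.store _ _ _ s₂)), ?_, ?_, hz a⟩
  · simp only [Polynomial.eval_add, Polynomial.eval_one]; omega
  · rw [hv', hl' _ (by omega), hv]
    exact h a s₂ (c.congr hs₁ ha' fun r h => hl' r (by omega))

theorem bind {F : α → ℕ → α} (hf : Comp c f)
    (hF : ∀ m, Cmd (c.ext m) fun x => (F x.1 x.2, x.2)) : Cmd c fun a => F a (f a) := by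
  obtain ⟨p, P, H⟩ := hf c.lvl le_rfl
  -- With `m = 0` the extra variable lies in register `c.lvl`, where `p` has just put `f a`.
  obtain ⟨q, Q, H'⟩ := hF 0
  refine ⟨.seq p q, P + Q, fun a s hs => ?_⟩
  obtain ⟨t, s₁, hr, ht, ha, hl, hv⟩ := H a s hs
  obtain ⟨t', s₂, hr', ht', hs₂, hz⟩ := H' (a, f a) s₁ ⟨c.congr hs ha hl, by simpa using hv⟩
  have hsz : (c.ext 0).size (a, f a) = c.size a := rfl
  rw [hsz] at ht'
  exact ⟨_, s₂, .seq hr hr', by rw [Polynomial.eval_add]; omega, hs₂.1, hz⟩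

theorem loop {F : ℕ → α → α} (hF : ∀ m, Cmd (c.ext m) fun x => (F x.2 x.1, x.2)) :
    Cmd c fun a => loopN F a (c.size a) := by
  obtain ⟨p, P, H⟩ := hF 0
  set m := c.lvl with hm
  refine ⟨.seq (.const m 0) (.seq (.copy (m + 1) 0)
    (.loop (m + 1) (.seq p (.seq (.succ m) (.sub (m + 1) 0 m))))),
    1 + (1 + (Polynomial.X * (P + 3) + 1)), fun a s hs => ?_⟩
  have hpos := c.pos
  obtain ⟨t', s', hr', ht', hs', -, hz', -⟩ := RAMProgram.Runs.loop_of_invariant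
    (r := m + 1) (p := .seq p (.seq (.succ m) (.sub (m + 1) 0 m))) (N := c.size a)
    (b := P.eval (c.size a) + 2)
    (I := fun j s' => c.Holds (loopN F a j) s' ∧ s'.reg m = j ∧
      c.size (loopN F a j) = c.size a ∧ s'.reg (m + 1) = c.size a - j)
    (fun j s' hj h => by rw [h.2.2.2]; omega)
    (by
      rintro j hj s' ⟨i₁, i₂, i₃, i₄⟩
      obtain ⟨t', s₂, hr', ht', hs₂, hz⟩ := H (loopN F a j, j) s' ⟨i₁, by simpa using i₂⟩
      have ht' : t' ≤ P.eval (c.size (loopN F a j)) := ht'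
      have hz : c.size (F j (loopN F a j)) = c.size (loopN F a j) := hz
      have h₂ : c.Holds (F j (loopN F a j)) s₂ := hs₂.1
      have h₃ : s₂.reg m = j := by simpa using hs₂.2
      rw [i₃] at ht' hz
      refine ⟨_, _, .seq hr' (.seq (.succ _ _) (.sub _ _ _ _)), by omega, ?_, ?_, hz, ?_⟩
      · refine c.congr h₂ rfl fun r hr => ?_
        rw [RAMState.setReg_reg_of_ne _ _ (by omega), RAMState.setReg_reg_of_ne _ _ (by omega)]
      · rw [RAMState.setReg_reg_of_ne _ _ (by omega), RAMState.setReg_reg_self, h₃]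
      · rw [RAMState.setReg_reg_self, RAMState.setReg_reg_self,
          RAMState.setReg_reg_of_ne _ _ (by omega), h₃, c.reg_zero h₂, hz])
    (s := (s.setReg m 0).setReg (m + 1) ((s.setReg m 0).reg 0))
    ⟨c.congr hs rfl fun r hr => by
        rw [RAMState.setReg_reg_of_ne _ _ (by omega), RAMState.setReg_reg_of_ne _ _ (by omega)],
      by rw [RAMState.setReg_reg_of_ne _ _ (by omega), RAMState.setReg_reg_self], rfl,
      by rw [RAMState.setReg_reg_self, RAMState.setReg_reg_of_ne _ _ (by omega),
          c.reg_zero hs]; rfl⟩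
  refine ⟨_, s', .seq (.const _ _ _) (.seq (.copy _ _ _) hr'), ?_, hs', hz'⟩
  simp only [Polynomial.eval_add, Polynomial.eval_one, Polynomial.eval_mul, Polynomial.eval_X,
    Polynomial.eval_ofNat]
  have : c.size a * (P.eval (c.size a) + 2 + 1) = c.size a * (P.eval (c.size a) + 3) := rfl
  omega

end Cmd

/-! ### The algorithm on arrays -/

/-- `u * n + v`, computed by counting. -/
def matIndex (n u v : ℕ) : ℕ :=
  loopN (fun i x => if i < u then loopN (fun _ y => y + 1) x n else x) v n

/-- `u` and `v` are equal or adjacent. -/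
def ClosedAdj (A : ℕ → ℕ) (n u v : ℕ) : Prop := u = v ∨ A (matIndex n u v) ≠ 0

/-- `w` lies in the closed neighbourhood of `T`. -/
def Covered (A : ℕ → ℕ) (n : ℕ) (T : ℕ → ℕ) (w : ℕ) : Prop :=
  ∃ u < n, T u ≠ 0 ∧ ClosedAdj A n u w

/-- The number of vertices that `v` covers and `T` does not. -/
noncomputable def coverGain (A : ℕ → ℕ) (n : ℕ) (T : ℕ → ℕ) (v : ℕ) : ℕ :=
  countBelow n fun w => ¬Covered A n T w ∧ ClosedAdj A n v w

/-- The first vertex outside `T` of largest gain. -/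
noncomputable def greedyVertex (A : ℕ → ℕ) (n : ℕ) (T : ℕ → ℕ) : ℕ :=
  firstBelow n fun v => T v = 0 ∧ ∀ u < n, T u = 0 → coverGain A n T u ≤ coverGain A n T v

/-- The closed neighbourhoods of `u` and `v` meet. -/
def Near (A : ℕ → ℕ) (n u v : ℕ) : Prop := ∃ w < n, ClosedAdj A n u w ∧ ClosedAdj A n v w

/-- The number of vertices near `v`. -/
noncomputable def nearCount (A : ℕ → ℕ) (n v : ℕ) : ℕ := countBelow n fun u => Near A n u v

/-- The vertex near `v` that has `d` predecessors near `v`. -/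
noncomputable def nearVertex (A : ℕ → ℕ) (n v d : ℕ) : ℕ :=
  firstBelow n fun u => Near A n u v ∧ (countBelow n fun u' => u' < u ∧ Near A n u' v) = d

/-- The vertex added to `T` in the branch `d`. -/
noncomputable def branchVertex (A : ℕ → ℕ) (n : ℕ) (T : ℕ → ℕ) (d : ℕ) : ℕ :=
  if nearVertex A n (greedyVertex A n T) d < n ∧
    T (nearVertex A n (greedyVertex A n T) d) = 0
  then nearVertex A n (greedyVertex A n T) d else greedyVertex A n T

/-- The number of vertices outside `T` that `T` covers. -/
noncomputable def solutionValue (A : ℕ → ℕ) (n : ℕ) (T : ℕ → ℕ) : ℕ :=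
  countBelow n fun w => T w = 0 ∧ Covered A n T w

/-- The largest number of vertices near a vertex. -/
noncomputable def branchCount (A : ℕ → ℕ) (n : ℕ) : ℕ :=
  firstBelow n fun d => ∀ v < n, nearCount A n v ≤ d

/-- The first of the `k` digits that is not `D - 1`. -/
noncomputable def carryPosition (n k D : ℕ) (dig : ℕ → ℕ) : ℕ :=
  firstBelow n fun j => k ≤ j ∨ dig j + 1 ≠ D

/-! ### The quantities of the algorithm are computable in polynomial time -/

section Comp

variable {α : Type} {c : Ctx α} {f g : α → ℕ} {A T : α → ℕ → ℕ} {i j : ℕ}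

theorem Comp.matIndex (hf : Comp c f) (hg : Comp c g) :
    Comp c fun a => matIndex (c.size a) (f a) (g a) := by
  refine hg.loop (h := fun a i x => if i < f a then loopN (fun _ y => y + 1) x (c.size a) else x)
    fun m m' => ?_
  have hx : Comp ((c.ext m).ext m') fun x => x.1.2 := (Comp.last c m).weaken m'
  refine Comp.ite (CompPred.lt (Comp.last _ _) ((hf.weaken m).weaken m')) ?_ hx
  exact hx.loop (h := fun _ _ y => y + 1) fun l l' => ((Comp.last _ l).weaken l').succ

theorem CompPred.closedAdj (hA : ∀ a s, c.Holds a s → s.arr i = A a) (hf : Comp c f)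
    (hg : Comp c g) : CompPred c fun a => ClosedAdj (A a) (c.size a) (f a) (g a) :=
  (CompPred.eq hf hg).or
    (CompPred.eq (Comp.load i hA (hf.matIndex hg)) (Comp.const c 0)).not

theorem CompPred.covered (hA : ∀ a s, c.Holds a s → s.arr i = A a)
    (hT : ∀ a s, c.Holds a s → s.arr j = T a) (hf : Comp c f) :
    CompPred c fun a => Covered (A a) (c.size a) (T a) (f a) := by
  refine CompPred.exists_lt
    (r := fun a u => T a u ≠ 0 ∧ ClosedAdj (A a) (c.size a) u (f a)) fun m => ?_
  refine (CompPred.eq ?_ (Comp.const _ 0)).not.and ?_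
  · exact Comp.load (c := c.ext m) j (F := fun x => T x.1) (fun a s h => hT a.1 s h.1) (Comp.last c m)
  · exact CompPred.closedAdj (c := c.ext m) (A := fun x => A x.1) (fun a s h => hA a.1 s h.1)
      (Comp.last c m) (hf.weaken m)

theorem Comp.coverGain (hA : ∀ a s, c.Holds a s → s.arr i = A a)
    (hT : ∀ a s, c.Holds a s → s.arr j = T a) (hf : Comp c f) :
    Comp c fun a => coverGain (A a) (c.size a) (T a) (f a) := by
  refine CompPred.count (r := fun a w => ¬Covered (A a) (c.size a) (T a) w ∧
    ClosedAdj (A a) (c.size a) (f a) w) fun m => ?_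
  refine (CompPred.covered (c := c.ext m) (A := fun x => A x.1) (T := fun x => T x.1)
    (fun a s h => hA a.1 s h.1) (fun a s h => hT a.1 s h.1) (Comp.last c m)).not.and ?_
  exact CompPred.closedAdj (c := c.ext m) (A := fun x => A x.1) (fun a s h => hA a.1 s h.1)
    (hf.weaken m) (Comp.last c m)

theorem Comp.greedyVertex (hA : ∀ a s, c.Holds a s → s.arr i = A a)
    (hT : ∀ a s, c.Holds a s → s.arr j = T a) :
    Comp c fun a => greedyVertex (A a) (c.size a) (T a) := by
  refine CompPred.first (r := fun a v => T a v = 0 ∧ ∀ u < c.size a, T a u = 0 →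
    _root_.coverGain (A a) (c.size a) (T a) u ≤ _root_.coverGain (A a) (c.size a) (T a) v)
    fun m => ?_
  refine (CompPred.eq ?_ (Comp.const _ 0)).and ?_
  · exact Comp.load (c := c.ext m) j (F := fun x => T x.1) (fun a s h => hT a.1 s h.1) (Comp.last c m)
  refine CompPred.forall_lt (c := c.ext m) (r := fun x u => T x.1 u = 0 →
    _root_.coverGain (A x.1) (c.size x.1) (T x.1) u ≤
      _root_.coverGain (A x.1) (c.size x.1) (T x.1) x.2) fun m' => ?_
  have hA' : ∀ a s, ((c.ext m).ext m').Holds a s → s.arr i = A a.1.1 :=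
    fun a s h => hA a.1.1 s h.1.1
  have hT' : ∀ a s, ((c.ext m).ext m').Holds a s → s.arr j = T a.1.1 :=
    fun a s h => hT a.1.1 s h.1.1
  refine (CompPred.eq (Comp.load j hT' (Comp.last _ m')) (Comp.const _ 0)).imp (CompPred.le ?_ ?_)
  · exact Comp.coverGain hA' hT' (Comp.last _ m')
  · exact Comp.coverGain hA' hT' ((Comp.last c m).weaken m')

theorem CompPred.near (hA : ∀ a s, c.Holds a s → s.arr i = A a) (hf : Comp c f)
    (hg : Comp c g) : CompPred c fun a => Near (A a) (c.size a) (f a) (g a) := by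
  refine CompPred.exists_lt (r := fun a w => ClosedAdj (A a) (c.size a) (f a) w ∧
    ClosedAdj (A a) (c.size a) (g a) w) fun m => ?_
  have hA' : ∀ a s, (c.ext m).Holds a s → s.arr i = A a.1 := fun a s h => hA a.1 s h.1
  exact (CompPred.closedAdj hA' (hf.weaken m) (Comp.last c m)).and
    (CompPred.closedAdj hA' (hg.weaken m) (Comp.last c m))

theorem Comp.nearCount (hA : ∀ a s, c.Holds a s → s.arr i = A a) (hf : Comp c f) :
    Comp c fun a => nearCount (A a) (c.size a) (f a) :=
  CompPred.count (r := fun a u => Near (A a) (c.size a) u (f a)) fun m =>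
    CompPred.near (c := c.ext m) (A := fun x => A x.1) (fun a s h => hA a.1 s h.1)
      (Comp.last c m) (hf.weaken m)

theorem Comp.nearVertex (hA : ∀ a s, c.Holds a s → s.arr i = A a) (hf : Comp c f)
    (hg : Comp c g) : Comp c fun a => nearVertex (A a) (c.size a) (f a) (g a) := by
  refine CompPred.first (r := fun a u => Near (A a) (c.size a) u (f a) ∧
    (countBelow (c.size a) fun u' => u' < u ∧ Near (A a) (c.size a) u' (f a)) = g a) fun m => ?_
  refine (CompPred.near (c := c.ext m) (A := fun x => A x.1) (fun a s h => hA a.1 s h.1)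
    (Comp.last c m) (hf.weaken m)).and (CompPred.eq ?_ (hg.weaken m))
  refine CompPred.count (c := c.ext m)
    (r := fun x u' => u' < x.2 ∧ Near (A x.1) (c.size x.1) u' (f x.1)) fun m' => ?_
  exact (CompPred.lt (Comp.last _ m') ((Comp.last c m).weaken m')).and
    (CompPred.near (c := (c.ext m).ext m') (A := fun x => A x.1.1)
      (fun a s h => hA a.1.1 s h.1.1) (Comp.last _ m') ((hf.weaken m).weaken m'))

theorem Comp.branchVertex (hA : ∀ a s, c.Holds a s → s.arr i = A a)
    (hT : ∀ a s, c.Holds a s → s.arr j = T a) (hf : Comp c f) :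
    Comp c fun a => branchVertex (A a) (c.size a) (T a) (f a) := by
  have hv := Comp.greedyVertex hA hT
  have hu := Comp.nearVertex hA hv hf
  exact Comp.ite ((CompPred.lt hu (Comp.size c)).and
    (CompPred.eq (Comp.load j hT hu) (Comp.const c 0))) hu hv

theorem Comp.solutionValue (hA : ∀ a s, c.Holds a s → s.arr i = A a)
    (hT : ∀ a s, c.Holds a s → s.arr j = T a) :
    Comp c fun a => solutionValue (A a) (c.size a) (T a) := by
  refine CompPred.count (r := fun a w => T a w = 0 ∧ Covered (A a) (c.size a) (T a) w)
    fun m => ?_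
  have hA' : ∀ a s, (c.ext m).Holds a s → s.arr i = A a.1 := fun a s h => hA a.1 s h.1
  have hT' : ∀ a s, (c.ext m).Holds a s → s.arr j = T a.1 := fun a s h => hT a.1 s h.1
  exact (CompPred.eq (Comp.load j hT' (Comp.last c m)) (Comp.const _ 0)).and
    (CompPred.covered hA' hT' (Comp.last c m))

theorem Comp.branchCount (hA : ∀ a s, c.Holds a s → s.arr i = A a) :
    Comp c fun a => branchCount (A a) (c.size a) := by
  refine CompPred.first (r := fun a d => ∀ v < c.size a, _root_.nearCount (A a) (c.size a) v ≤ d)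
    fun m => ?_
  refine CompPred.forall_lt (c := c.ext m)
    (r := fun x v => _root_.nearCount (A x.1) (c.size x.1) v ≤ x.2) fun m' => ?_
  exact CompPred.le (Comp.nearCount (c := (c.ext m).ext m') (A := fun x => A x.1.1)
    (fun a s h => hA a.1.1 s h.1.1) (Comp.last _ m')) ((Comp.last c m).weaken m')

theorem Comp.carryPosition {dig : α → ℕ → ℕ} (hdig : ∀ a s, c.Holds a s → s.arr j = dig a)
    (hf : Comp c f) (hg : Comp c g) :
    Comp c fun a => carryPosition (c.size a) (f a) (g a) (dig a) := by
  refine CompPred.first (r := fun a j => f a ≤ j ∨ dig a j + 1 ≠ g a) fun m => ?_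
  have hd' : ∀ a s, (c.ext m).Holds a s → s.arr j = dig a.1 := fun a s h => hdig a.1 s h.1
  exact (CompPred.le (hf.weaken m) (Comp.last c m)).or
    (CompPred.eq (Comp.load j hd' (Comp.last c m)).succ (hg.weaken m)).not

end Comp

/-! ### The memory of the algorithm -/

/-- The memory: the graph `A` with its order `n`, the size `k` of the solution, the number `D`
of branches, the flag `run`, the current partial solution `T`, the current branches `dig`, and
the best solution `B` so far with its value `best`. -/
structure Mem where
  n : ℕ
  k : ℕ
  D : ℕ
  best : ℕ
  run : ℕ
  A : ℕ → ℕ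
  B : ℕ → ℕ
  T : ℕ → ℕ
  dig : ℕ → ℕ

/-- The layout of the memory. -/
def memCtx : Ctx Mem where
  lvl := 5
  size := Mem.n
  Holds a s := s.reg 0 = a.n ∧ s.reg 1 = a.k ∧ s.reg 2 = a.D ∧ s.reg 3 = a.best ∧
    s.reg 4 = a.run ∧ s.arr 0 = a.A ∧ s.arr 1 = a.B ∧ s.arr 2 = a.T ∧ s.arr 3 = a.dig
  pos := by omega
  reg_zero h := h.1
  congr := by
    rintro a s s' h ha hr
    rw [ha, hr 0 (by omega), hr 1 (by omega), hr 2 (by omega), hr 3 (by omega), hr 4 (by omega)]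
    exact h

namespace Mem

/-- Empty the partial solution. -/
def clear (a : Mem) : Mem :=
  loopN (fun i a => { a with T := Function.update a.T i 0 }) a a.n

/-- Add a vertex in the branch `dig j` if `j < k`. -/
noncomputable def extend (j : ℕ) (a : Mem) : Mem :=
  if j < a.k then { a with T := (Function.update a.T (branchVertex a.A a.n a.T (a.dig j)) 1) } else a

/-- Follow all branches. -/
noncomputable def build (a : Mem) : Mem := loopN extend a a.n

/-- Keep the current solution if it is at least as good as the best one so far. -/
noncomputable def record (a : Mem) : Mem :=
  if a.best ≤ solutionValue a.A a.n a.T then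
    loopN (fun i a => { a with B := Function.update a.B i (a.T i) })
      { a with best := solutionValue a.A a.n a.T } a.n
  else a

/-- Increment the digits below the first `q` and the digit at `q`, without carrying. -/
def bump (q : ℕ) (a : Mem) : Mem :=
  loopN (fun i a => { a with dig := (Function.update a.dig i
    (if i < q then 0 else if i = q then a.dig i + 1 else a.dig i)) }) a a.n

/-- Go to the next sequence of branches. -/
noncomputable def next (a : Mem) : Mem :=
  { bump (carryPosition a.n a.k a.D a.dig) a with
    run := ind (carryPosition a.n a.k a.D a.dig < a.k) }

/-- One round of the algorithm. -/
noncomputable def round (a : Mem) : Mem := a.clear.build.record.next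

/-- Start the algorithm. -/
noncomputable def start (a : Mem) : Mem := { a with D := branchCount a.A a.n, run := 1 }

/-! ### Closed forms of the array loops -/

theorem clear_eq (a : Mem) :
    a.clear = { a with T := fun i => if i < a.n then 0 else a.T i } := by
  suffices H : ∀ N, loopN (fun i a => { a with T := Function.update a.T i 0 }) a N =
      { a with T := fun i => if i < N then 0 else a.T i } from H a.n
  intro N
  induction N with
  | zero => rfl
  | succ N ih =>
    rw [loopN, ih]
    congr 1
    funext i
    simp only [Function.update_apply]
    split_ifs <;> first | rfl | omega

/-- Iteration `i` reads and writes only cell `i`, so the update in place agrees with the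
simultaneous one. -/
theorem bump_eq (q : ℕ) (a : Mem) : bump q a = { a with dig := (fun i => if i < a.n then
    (if i < q then 0 else if i = q then a.dig i + 1 else a.dig i) else a.dig i) } := by
  suffices H : ∀ N, loopN (fun i a => { a with dig := (Function.update a.dig i
      (if i < q then 0 else if i = q then a.dig i + 1 else a.dig i)) }) a N =
      { a with dig := (fun i => if i < N then
        (if i < q then 0 else if i = q then a.dig i + 1 else a.dig i) else a.dig i) } from H a.n
  intro N
  induction N with
  | zero => rfl
  | succ N ih =>
    rw [loopN, ih]
    congr 1
    funext i
    simp only [Function.update_apply]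
    split_ifs <;> first | rfl | omega | (subst_vars; simp_all)

theorem record_eq (a : Mem) : a.record =
    if a.best ≤ solutionValue a.A a.n a.T then { a with
      best := solutionValue a.A a.n a.T
      B := fun i => if i < a.n then a.T i else a.B i }
    else a := by
  suffices H : ∀ N, loopN (fun i a => { a with B := Function.update a.B i (a.T i) })
      { a with best := solutionValue a.A a.n a.T } N = { a with
      best := solutionValue a.A a.n a.T
      B := fun i => if i < N then a.T i else a.B i } by
    unfold record
    rw [H]
  intro N
  induction N with
  | zero => rfl
  | succ N ih =>
    rw [loopN, ih]
    congr 1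
    funext i
    simp only [Function.update_apply]
    split_ifs <;> first | rfl | omega | (subst_vars; simp_all)

/-! ### The memory operations as polynomial-time programs -/

theorem cmd_clear : Cmd memCtx clear := by
  refine Cmd.loop (c := memCtx) fun m => ?_
  refine Cmd.store 2 (Comp.last _ m) (Comp.const _ 0) ?_ fun _ => rfl
  rintro ⟨a, i⟩ s ⟨h, h'⟩
  obtain ⟨h0, h1, h2, h3, h4, h5, h6, h7, h8⟩ := h
  refine ⟨⟨h0, h1, h2, h3, h4, ?_, ?_, ?_, ?_⟩, h'⟩ <;> simp_all [RAMState.setArr]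

theorem cmd_extend (m : ℕ) : Cmd (memCtx.ext m) fun x => (extend x.2 x.1, x.2) := by
  have hk : Comp (memCtx.ext m) fun x => x.1.k := Comp.of_reg 1 fun _ _ h => h.1.2.1
  have hd : Comp (memCtx.ext m) fun x => x.1.dig x.2 :=
    Comp.load (c := memCtx.ext m) 3 (F := fun x => x.1.dig) (fun _ _ h => h.1.2.2.2.2.2.2.2.2) (Comp.last _ m)
  have hb : Comp (memCtx.ext m) fun x => branchVertex x.1.A x.1.n x.1.T (x.1.dig x.2) :=
    Comp.branchVertex (c := memCtx.ext m) (i := 0) (j := 2) (A := fun x => x.1.A)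
      (T := fun x => x.1.T) (fun _ _ h => h.1.2.2.2.2.2.1) (fun _ _ h => h.1.2.2.2.2.2.2.2.1) hd
  have hs : Cmd (memCtx.ext m) fun x =>
      ({ x.1 with T := (Function.update x.1.T
        (branchVertex x.1.A x.1.n x.1.T (x.1.dig x.2)) 1) }, x.2) := by
    refine Cmd.store 2 hb (Comp.const _ 1) ?_ fun _ => rfl
    rintro ⟨a, i⟩ s ⟨h, h'⟩
    obtain ⟨h0, h1, h2, h3, h4, h5, h6, h7, h8⟩ := h
    refine ⟨⟨h0, h1, h2, h3, h4, ?_, ?_, ?_, ?_⟩, h'⟩ <;> simp_all [RAMState.setArr]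
  have := Cmd.ite (CompPred.lt (Comp.last _ m) hk) hs (Cmd.id _)
  convert this using 2 with x
  unfold extend
  split_ifs <;> rfl

theorem cmd_build : Cmd memCtx build := Cmd.loop (c := memCtx) cmd_extend

theorem cmd_record : Cmd memCtx record := by
  have hv : Comp memCtx fun a => solutionValue a.A a.n a.T :=
    Comp.solutionValue (c := memCtx) (i := 0) (j := 2) (A := Mem.A) (T := Mem.T)
      (fun _ _ h => h.2.2.2.2.2.1) (fun _ _ h => h.2.2.2.2.2.2.2.1)
  have hb : Comp memCtx fun a => a.best := Comp.of_reg 3 fun _ _ h => h.2.2.2.1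
  have h₁ : Cmd memCtx fun a => { a with best := solutionValue a.A a.n a.T } := by
    refine Cmd.set 3 hv ?_ fun _ => rfl
    rintro a s ⟨h0, h1, h2, h3, h4, h5, h6, h7, h8⟩
    refine ⟨?_, ?_, ?_, ?_, ?_, h5, h6, h7, h8⟩ <;> simp_all [RAMState.setReg]
  have h₂ : Cmd memCtx fun a =>
      loopN (fun i a => { a with B := Function.update a.B i (a.T i) }) a a.n := by
    refine Cmd.loop (c := memCtx) fun m => ?_
    refine Cmd.store 1 (Comp.last _ m) (Comp.load (c := memCtx.ext m) 2 (F := fun x => x.1.T)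
      (fun _ _ h => h.1.2.2.2.2.2.2.2.1) (Comp.last _ m)) ?_ fun _ => rfl
    rintro ⟨a, i⟩ s ⟨h, h'⟩
    obtain ⟨h0, h1, h2, h3, h4, h5, h6, h7, h8⟩ := h
    refine ⟨⟨h0, h1, h2, h3, h4, ?_, ?_, ?_, ?_⟩, h'⟩ <;> simp_all [RAMState.setArr]
  exact Cmd.ite (CompPred.le hb hv) (h₁.seq h₂) (Cmd.id _)

theorem cmd_next : Cmd memCtx next := by
  have hq : Comp memCtx fun a => carryPosition a.n a.k a.D a.dig :=
    Comp.carryPosition (c := memCtx) (j := 3) (dig := Mem.dig)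
      (fun _ _ h => h.2.2.2.2.2.2.2.2) (Comp.of_reg 1 fun _ _ h => h.2.1)
      (Comp.of_reg 2 fun _ _ h => h.2.2.1)
  have hk : Comp memCtx fun a => a.k := Comp.of_reg 1 fun _ _ h => h.2.1
  -- The carry position is evaluated once and saved, because the loop that follows alters the digits
  -- it depends on.
  refine Cmd.bind (F := fun a q => { bump q a with run := ind (q < a.k) }) hq fun m => ?_
  have h₁ : Cmd (memCtx.ext m) fun x => ({ x.1 with run := ind (x.2 < x.1.k) }, x.2) := by
    refine Cmd.set 4 (CompPred.lt (Comp.last _ m) (hk.weaken m)) ?_ fun _ => rfl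
    rintro ⟨a, i⟩ s ⟨h, h'⟩
    obtain ⟨h0, h1, h2, h3, h4, h5, h6, h7, h8⟩ := h
    have : max memCtx.lvl m ≠ 4 := by simp only [memCtx]; omega
    refine ⟨⟨?_, ?_, ?_, ?_, ?_, h5, h6, h7, h8⟩, ?_⟩ <;> simp_all [RAMState.setReg]
  have h₂ : Cmd (memCtx.ext m) fun x => (bump x.2 x.1, x.2) := by
    have : Cmd (memCtx.ext m) fun x => loopN (fun i x => ({ x.1 with
        dig := (Function.update x.1.dig i
          (if i < x.2 then 0 else if i = x.2 then x.1.dig i + 1 else x.1.dig i)) }, x.2)) x x.1.n := by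
      refine Cmd.loop (c := memCtx.ext m) fun m' => ?_
      have hd : Comp ((memCtx.ext m).ext m') fun x => x.1.1.dig x.2 :=
        Comp.load (c := (memCtx.ext m).ext m') 3 (F := fun x => x.1.1.dig) (fun _ _ h => h.1.1.2.2.2.2.2.2.2.2)
          (Comp.last _ m')
      have hi := (Comp.last memCtx m).weaken m'
      refine Cmd.store 3 (Comp.last _ m') (Comp.ite (CompPred.lt (Comp.last _ m') hi)
        (Comp.const _ 0) (Comp.ite (CompPred.eq (Comp.last _ m') hi) hd.succ hd)) ?_ fun _ => rfl
      rintro ⟨⟨a, q⟩, i⟩ s ⟨⟨h, h'⟩, h''⟩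
      obtain ⟨h0, h1, h2, h3, h4, h5, h6, h7, h8⟩ := h
      refine ⟨⟨⟨h0, h1, h2, h3, h4, ?_, ?_, ?_, ?_⟩, h'⟩, h''⟩ <;> simp_all [RAMState.setArr]
    -- The loop just built carries `q` along unchanged as a second component; its first component is
    -- `bump`.
    convert this using 2 with x
    unfold bump
    generalize x.1.n = N
    induction N with
    | zero => rfl
    | succ N ih => rw [loopN, loopN, ← ih]
  have := h₂.seq h₁
  simpa only [bump_eq] using this

theorem cmd_round : Cmd memCtx round := ((cmd_clear.seq cmd_build).seq cmd_record).seq cmd_next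

theorem cmd_start : Cmd memCtx start := by
  have hD : Comp memCtx fun a => branchCount a.A a.n :=
    Comp.branchCount (c := memCtx) (i := 0) (A := Mem.A) (fun _ _ h => h.2.2.2.2.2.1)
  have h₁ : Cmd memCtx fun a => { a with D := branchCount a.A a.n } := by
    refine Cmd.set 2 hD ?_ fun _ => rfl
    rintro a s ⟨h0, h1, h2, h3, h4, h5, h6, h7, h8⟩
    refine ⟨?_, ?_, ?_, ?_, ?_, h5, h6, h7, h8⟩ <;> simp_all [RAMState.setReg]
  have h₂ : Cmd memCtx fun a => { a with run := 1 } := by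
    refine Cmd.set 4 (Comp.const _ 1) ?_ fun _ => rfl
    rintro a s ⟨h0, h1, h2, h3, h4, h5, h6, h7, h8⟩
    refine ⟨?_, ?_, ?_, ?_, ?_, h5, h6, h7, h8⟩ <;> simp_all [RAMState.setReg]
  exact h₁.seq h₂

end Mem

/-! ### The exchange argument -/

namespace SimpleGraph

variable {V : Type*} [Fintype V] [DecidableEq V] (G : SimpleGraph V) [DecidableRel G.Adj]

/-- The vertices that are in `S` or have a neighbour in `S`. -/
def cover (S : Finset V) : Finset V := Finset.univ.filter fun w => ∃ u ∈ S, u = w ∨ G.Adj u w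

/-- The vertices whose closed neighbourhood meets that of `v`. -/
def nearby (v : V) : Finset V :=
  Finset.univ.filter fun u => ∃ w, (u = w ∨ G.Adj u w) ∧ (v = w ∨ G.Adj v w)

variable {G}

theorem mem_cover {S : Finset V} {w : V} : w ∈ G.cover S ↔ ∃ u ∈ S, u = w ∨ G.Adj u w := by
  simp [cover]

theorem mem_nearby {u v : V} :
    u ∈ G.nearby v ↔ ∃ w, (u = w ∨ G.Adj u w) ∧ (v = w ∨ G.Adj v w) := by
  simp [nearby]

theorem self_mem_nearby (v : V) : v ∈ G.nearby v := mem_nearby.2 ⟨v, .inl rfl, .inl rfl⟩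

/-- Every set covers itself. So among sets of a fixed size, maximizing the dominated vertices is the
same as maximizing the cover. -/
theorem dominatedCount_add_card (S : Finset V) :
    dominatedCount G S + S.card = (G.cover S).card := by
  classical
  have hS : S ⊆ G.cover S := fun v hv => mem_cover.2 ⟨v, hv, .inl rfl⟩
  rw [← Finset.card_sdiff_add_card_eq_card hS, dominatedCount]
  congr 2
  ext v
  simp only [Finset.mem_filter, Finset.mem_univ, true_and, Finset.mem_sdiff, mem_cover]
  constructor
  · rintro ⟨h, u, hu, huv⟩
    exact ⟨⟨u, hu, .inr huv⟩, h⟩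
  · rintro ⟨⟨u, hu, rfl | huv⟩, h⟩
    · exact absurd hu h
    · exact ⟨h, u, hu, huv⟩

theorem cover_insert (S : Finset V) (v : V) :
    G.cover (insert v S) = G.cover {v} ∪ G.cover S := by
  ext w
  simp [mem_cover]

theorem card_cover_insert (S : Finset V) (v : V) :
    (G.cover (insert v S)).card = (G.cover {v} \ G.cover S).card + (G.cover S).card := by
  rw [cover_insert, ← Finset.sdiff_union_self_eq_union,
    Finset.card_union_of_disjoint Finset.sdiff_disjoint]

theorem cover_mono {S S' : Finset V} (h : S ⊆ S') : G.cover S ⊆ G.cover S' := fun w hw => by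
  obtain ⟨u, hu, huw⟩ := mem_cover.1 hw
  exact mem_cover.2 ⟨u, h hu, huw⟩

/-- If `v` has the largest gain over `T`, then some optimal extension of `T` contains a vertex
near `v`. -/
theorem exists_optimal_insert {k : ℕ} {S T : Finset V} {v : V} (hS : IsMaxKDominating G k S)
    (hTS : T ⊆ S) (hT : T.card < k) (hv : v ∉ T)
    (hgreedy : ∀ u ∉ T, (G.cover {u} \ G.cover T).card ≤ (G.cover {v} \ G.cover T).card) :
    ∃ S', IsMaxKDominating G k S' ∧ ∃ u ∈ G.nearby v, u ∉ T ∧ insert u T ⊆ S' := by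
  by_cases h : ∃ u ∈ S \ T, u ∈ G.nearby v
  · obtain ⟨u, hu, huv⟩ := h
    rw [Finset.mem_sdiff] at hu
    exact ⟨S, hS, u, huv, hu.2, Finset.insert_subset hu.1 hTS⟩
  push Not at h
  -- From here `S \ T` has no vertex near `v`; in particular `v` itself is not in it. An arbitrary
  -- `w` of `S \ T` is exchanged for `v`.
  have hvS : v ∉ S := fun hvS => h v (Finset.mem_sdiff.2 ⟨hvS, hv⟩) (self_mem_nearby v)
  obtain ⟨w, hw⟩ : (S \ T).Nonempty := by
    rw [← Finset.card_pos, Finset.card_sdiff_of_subset hTS, hS.1]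
    omega
  obtain ⟨hwS, hwT⟩ := Finset.mem_sdiff.1 hw
  set R := S.erase w with hR
  have hRS : insert w R = S := Finset.insert_erase hwS
  have hTR : T ⊆ R := fun u hu => Finset.mem_erase.2 ⟨fun h => hwT (h ▸ hu), hTS hu⟩
  have hvR : v ∉ R := fun h => hvS (Finset.mem_of_mem_erase h)
  have hcard : (insert v R).card = k := by
    rw [Finset.card_insert_of_notMem hvR, hR, Finset.card_erase_of_mem hwS, hS.1]
    omega
  -- A vertex of `R \ T` sharing a covered vertex with `v` would be near `v`, so enlarging `T` to
  -- `R` costs `v` no gain.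
  have h₁ : G.cover {v} \ G.cover T ⊆ G.cover {v} \ G.cover R := by
    intro x hx
    rw [Finset.mem_sdiff] at hx ⊢
    refine ⟨hx.1, fun hxR => ?_⟩
    obtain ⟨u, hu, hux⟩ := mem_cover.1 hxR
    by_cases huT : u ∈ T
    · exact hx.2 (mem_cover.2 ⟨u, huT, hux⟩)
    · obtain ⟨v', hv', hvx⟩ := mem_cover.1 hx.1
      rw [Finset.mem_singleton] at hv'
      subst hv'
      exact h u (Finset.mem_sdiff.2 ⟨Finset.mem_of_mem_erase hu, huT⟩)
        (mem_nearby.2 ⟨x, hux, hvx⟩)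
  -- The gain of `w` can only shrink from `T` to `R`, and over `T` it was at most that of `v` by
  -- greedy choice.
  have h₂ : (G.cover {w} \ G.cover R).card ≤ (G.cover {v} \ G.cover R).card :=
    (Finset.card_le_card (Finset.sdiff_subset_sdiff subset_rfl (cover_mono hTR))).trans
      ((hgreedy w hwT).trans (Finset.card_le_card h₁))
  have h₃ : dominatedCount G S ≤ dominatedCount G (insert v R) := by
    have e₁ := dominatedCount_add_card (G := G) S
    have e₂ := dominatedCount_add_card (G := G) (insert v R)
    rw [hcard, card_cover_insert] at e₂
    rw [hS.1, ← hRS, card_cover_insert, hRS] at e₁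
    omega
  exact ⟨insert v R, ⟨hcard, fun S' h' => (hS.2 S' h').trans h₃⟩, v, self_mem_nearby v, hv,
    Finset.insert_subset_insert v hTR⟩

/-- Apart from `v`, every nearby vertex is a neighbour `w` of `v` or a neighbour of such a `w`.
Since `v` is itself a neighbour of `w`, deleting it makes room for `w`, and each `w` contributes at
most `Δ` vertices. -/
theorem card_nearby_le (v : V) : (G.nearby v).card ≤ G.maxDegree * G.maxDegree + 1 := by
  have hsub : G.nearby v ⊆
      insert v ((G.neighborFinset v).biUnion fun w => insert w ((G.neighborFinset w).erase v)) := by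
    intro u hu
    obtain ⟨w, huw, hvw⟩ := mem_nearby.1 hu
    simp only [Finset.mem_insert, Finset.mem_biUnion, mem_neighborFinset, Finset.mem_erase]
    by_cases huv : u = v
    · exact .inl huv
    · right
      rcases hvw with rfl | hvw
      · rcases huw with rfl | huw
        · exact absurd rfl huv
        · exact ⟨u, huw.symm, .inl rfl⟩
      · rcases huw with rfl | huw
        · exact ⟨u, hvw, .inl rfl⟩
        · exact ⟨w, hvw, .inr ⟨huv, huw.symm⟩⟩
  refine (Finset.card_le_card hsub).trans ((Finset.card_insert_le _ _).trans ?_)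
  gcongr
  refine (Finset.card_biUnion_le_card_mul _ _ G.maxDegree fun w hw => ?_).trans
    (Nat.mul_le_mul_right _ ?_)
  · rw [mem_neighborFinset] at hw
    refine (Finset.card_insert_le _ _).trans ?_
    have hv : v ∈ G.neighborFinset w := by simpa using hw.symm
    rw [Finset.card_erase_add_one hv, card_neighborFinset_eq_degree]
    exact G.degree_le_maxDegree w
  · rw [card_neighborFinset_eq_degree]
    exact G.degree_le_maxDegree v

end SimpleGraph

/-- For positive `d` one has `d² + 1 ≤ 2d²`, and the resulting `2^k` is absorbed by `k^(2k)` as soon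
as `k ≥ 2`. The factor 2 is needed for `k = 1`; the maximum with 1 covers `d = 0`. -/
theorem sq_add_one_pow_le (d k : ℕ) : (d * d + 1) ^ k ≤ 2 * max 1 ((d * k) ^ (2 * k)) := by
  rcases Nat.eq_zero_or_pos d with rfl | hd
  · simp only [zero_mul, zero_add, one_pow]
    omega
  rcases Nat.eq_zero_or_pos k with rfl | hk
  · simp
  have h₁ : d * d + 1 ≤ 2 * (d * d) := by nlinarith
  have h₂ : (2 : ℕ) ^ k ≤ 2 * k ^ (2 * k) := by
    rcases Nat.eq_or_lt_of_le hk with rfl | hk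
    · norm_num
    · calc 2 ^ k ≤ k ^ k := Nat.pow_le_pow_left hk k
        _ ≤ k ^ (2 * k) := Nat.pow_le_pow_right (by omega) (by omega)
        _ ≤ 2 * k ^ (2 * k) := by omega
  calc (d * d + 1) ^ k ≤ (2 * (d * d)) ^ k := Nat.pow_le_pow_left h₁ k
    _ = 2 ^ k * d ^ (2 * k) := by rw [mul_pow, pow_mul, sq]
    _ ≤ 2 * k ^ (2 * k) * d ^ (2 * k) := Nat.mul_le_mul_right _ h₂
    _ = 2 * (d * k) ^ (2 * k) := by rw [mul_pow]; ring
    _ ≤ _ := Nat.mul_le_mul_left _ (le_max_right _ _)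

/-! ### Correctness of the algorithm on arrays -/

/-- The indicator vector of `S`. -/
noncomputable def indic {n : ℕ} (S : Finset (Fin n)) (i : ℕ) : ℕ := ind (∃ h : i < n, ⟨i, h⟩ ∈ S)

section Bridge

variable {n : ℕ} {G : SimpleGraph (Fin n)} {A : ℕ → ℕ}

theorem indic_eq_zero {S : Finset (Fin n)} {v : Fin n} : indic S v = 0 ↔ v ∉ S := by
  simp [indic, ind_eq_zero]

theorem indic_empty : indic (∅ : Finset (Fin n)) = fun _ => 0 := by
  funext i
  simp [indic, ind]

theorem indic_insert (S : Finset (Fin n)) (v : Fin n) :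
    indic (insert v S) = Function.update (indic S) v 1 := by
  funext i
  rw [Function.update_apply]
  split_ifs with h
  · subst h
    exact ind_of ⟨v.2, Finset.mem_insert_self _ _⟩
  · unfold indic
    congr 1
    simp only [Finset.mem_insert, Fin.ext_iff, h, false_or]

theorem matIndex_eq {u : ℕ} (hu : u ≤ n) (v : ℕ) : matIndex n u v = u * n + v := by
  have h₁ : ∀ x m, loopN (fun _ y : ℕ => y + 1) x m = x + m := by
    intro x m
    induction m with
    | zero => rfl
    | succ m ih => rw [loopN, ih]; rfl
  have h₂ : ∀ m, loopN (fun i x => if i < u then loopN (fun _ y => y + 1) x n else x) v m =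
      min m u * n + v := by
    intro m
    induction m with
    | zero => simp [loopN]
    | succ m ih =>
      rw [loopN, ih, h₁]
      split_ifs with h
      · rw [min_eq_left (by omega), min_eq_left (by omega)]; ring
      · rw [min_eq_right (by omega), min_eq_right (by omega)]
  rw [matIndex, h₂, min_eq_right hu]

theorem countBelow_eq_card_fin (p : ℕ → Prop) [DecidablePred p] :
    countBelow n p = (Finset.univ.filter fun v : Fin n => p v).card := by
  rw [countBelow_eq_card, ← Finset.card_map Fin.valEmbedding]
  congr 1
  ext i
  simp only [Finset.mem_filter, Finset.mem_range, Finset.mem_map, Finset.mem_univ, true_and,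
    Fin.valEmbedding_apply]
  constructor
  · rintro ⟨hi, hp⟩
    exact ⟨⟨i, hi⟩, hp, rfl⟩
  · rintro ⟨v, hp, rfl⟩
    exact ⟨v.2, hp⟩

theorem closedAdj_iff (hA : ∀ u v : Fin n, A (u * n + v) ≠ 0 ↔ G.Adj u v) (u v : Fin n) :
    ClosedAdj A n u v ↔ u = v ∨ G.Adj u v := by
  rw [ClosedAdj, matIndex_eq u.2.le, hA, Fin.ext_iff]

variable [DecidableRel G.Adj]

theorem covered_iff (hA : ∀ u v : Fin n, A (u * n + v) ≠ 0 ↔ G.Adj u v) (S : Finset (Fin n))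
    (w : Fin n) : Covered A n (indic S) w ↔ w ∈ G.cover S := by
  rw [SimpleGraph.mem_cover]
  constructor
  · rintro ⟨u, hu, huS, huw⟩
    lift u to Fin n using hu
    exact ⟨u, by simpa [indic_eq_zero] using huS, (closedAdj_iff hA u w).1 huw⟩
  · rintro ⟨u, hu, huw⟩
    exact ⟨u, u.2, by simpa [indic_eq_zero] using hu, (closedAdj_iff hA u w).2 huw⟩

theorem coverGain_eq (hA : ∀ u v : Fin n, A (u * n + v) ≠ 0 ↔ G.Adj u v) (S : Finset (Fin n))
    (v : Fin n) : coverGain A n (indic S) v = (G.cover {v} \ G.cover S).card := by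
  classical
  rw [coverGain, countBelow_eq_card_fin]
  congr 1
  ext w
  simp [covered_iff hA, closedAdj_iff hA, SimpleGraph.mem_cover, and_comm]

theorem near_iff (hA : ∀ u v : Fin n, A (u * n + v) ≠ 0 ↔ G.Adj u v) (u v : Fin n) :
    Near A n u v ↔ u ∈ G.nearby v := by
  rw [SimpleGraph.mem_nearby]
  constructor
  · rintro ⟨w, hw, h₁, h₂⟩
    lift w to Fin n using hw
    exact ⟨w, (closedAdj_iff hA u w).1 h₁, (closedAdj_iff hA v w).1 h₂⟩
  · rintro ⟨w, h₁, h₂⟩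
    exact ⟨w, w.2, (closedAdj_iff hA u w).2 h₁, (closedAdj_iff hA v w).2 h₂⟩

theorem nearCount_eq (hA : ∀ u v : Fin n, A (u * n + v) ≠ 0 ↔ G.Adj u v) (v : Fin n) :
    nearCount A n v = (G.nearby v).card := by
  classical
  rw [nearCount, countBelow_eq_card_fin]
  congr 1
  ext u
  simp [near_iff hA]

theorem solutionValue_eq (hA : ∀ u v : Fin n, A (u * n + v) ≠ 0 ↔ G.Adj u v)
    (S : Finset (Fin n)) : solutionValue A n (indic S) = dominatedCount G S := by
  classical
  rw [solutionValue, countBelow_eq_card_fin, dominatedCount]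
  congr 1
  ext w
  simp only [Finset.mem_filter, Finset.mem_univ, true_and, indic_eq_zero, covered_iff hA,
    SimpleGraph.mem_cover]
  refine and_congr_right fun hw => exists_congr fun u => and_congr_right fun hu => ?_
  exact or_iff_right fun h => hw (h ▸ hu)

/-- The search for `branchCount` stops below `n`; if it fails, its default value `n` still bounds
every count. -/
theorem nearCount_le_branchCount {v : ℕ} (hv : v < n) : nearCount A n v ≤ branchCount A n := by
  classical
  by_cases h : ∃ d < n, ∀ v < n, nearCount A n v ≤ d
  · exact (firstBelow_spec h).2.1 v hv
  · push Not at h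
    rw [branchCount, firstBelow_of_forall_not (fun d hd => by push Not; exact h d hd), nearCount,
      countBelow_eq_card_fin]
    simpa using Finset.card_le_univ (Finset.univ.filter fun u : Fin n => Near A n u v)

theorem branchCount_le (hA : ∀ u v : Fin n, A (u * n + v) ≠ 0 ↔ G.Adj u v) :
    branchCount A n ≤ G.maxDegree * G.maxDegree + 1 := by
  by_contra! h
  have hn := firstBelow_le n fun d => ∀ v < n, nearCount A n v ≤ d
  have hp : ∀ v < n, nearCount A n v ≤ G.maxDegree * G.maxDegree + 1 := by
    intro v hv
    lift v to Fin n using hv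
    rw [nearCount_eq hA]
    exact SimpleGraph.card_nearby_le v
  exact (firstBelow_spec ⟨_, lt_of_lt_of_le h hn, hp⟩).2.2 _ h hp

/-- Each vertex is near itself. This makes 0 a legal digit at the start of the counter. -/
theorem branchCount_pos (hA : ∀ u v : Fin n, A (u * n + v) ≠ 0 ↔ G.Adj u v) (hn : 0 < n) :
    0 < branchCount A n := by
  refine lt_of_lt_of_le ?_ (nearCount_le_branchCount hn)
  have : nearCount A n (⟨0, hn⟩ : Fin n) = _ := nearCount_eq hA ⟨0, hn⟩
  rw [this, Finset.card_pos]
  exact ⟨_, SimpleGraph.self_mem_nearby _⟩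

theorem greedyVertex_spec (hA : ∀ u v : Fin n, A (u * n + v) ≠ 0 ↔ G.Adj u v)
    {S : Finset (Fin n)} (hS : S.card < n) : ∃ v : Fin n, greedyVertex A n (indic S) = v ∧ v ∉ S ∧
      ∀ u ∉ S, (G.cover {u} \ G.cover S).card ≤ (G.cover {v} \ G.cover S).card := by
  have hne : (Sᶜ).Nonempty := by
    rw [← Finset.card_pos, Finset.card_compl, Fintype.card_fin]
    omega
  obtain ⟨x, hx, hmax⟩ := Finset.exists_max_image Sᶜ
    (fun u => (G.cover {u} \ G.cover S).card) hne
  have hex : ∃ v < n, indic S v = 0 ∧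
      ∀ u < n, indic S u = 0 → coverGain A n (indic S) u ≤ coverGain A n (indic S) v := by
    refine ⟨x, x.2, indic_eq_zero.2 (by simpa using hx), fun u hu hu0 => ?_⟩
    lift u to Fin n using hu
    rw [coverGain_eq hA, coverGain_eq hA]
    exact hmax u (by simpa [indic_eq_zero] using hu0)
  obtain ⟨h₁, ⟨h₂, h₃⟩, -⟩ := firstBelow_spec hex
  refine ⟨⟨_, h₁⟩, rfl, indic_eq_zero.1 h₂, fun u hu => ?_⟩
  have := h₃ u u.2 (indic_eq_zero.2 hu)
  rwa [coverGain_eq hA, ← Fin.val_mk h₁, coverGain_eq hA] at this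

/-- The branch leading to `u` is its rank among the vertices near `v`. The rank is below their
number, and smaller near vertices have strictly smaller rank, so the search finds `u` first. -/
theorem nearVertex_eq {u v : ℕ} (hu : u < n) (huv : Near A n u v) :
    ∃ d < nearCount A n v, nearVertex A n v d = u := by
  classical
  refine ⟨countBelow n fun u' => u' < u ∧ Near A n u' v, ?_, ?_⟩
  · rw [nearCount, countBelow_eq_card, countBelow_eq_card]
    refine Finset.card_lt_card (Finset.ssubset_iff_of_subset ?_ |>.2 ⟨u, ?_, ?_⟩)
    · intro x
      simp only [Finset.mem_filter]
      tauto
    · simp [hu, huv]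
    · simp
  · refine firstBelow_of_first hu ⟨huv, rfl⟩ fun j hj ⟨hjv, h⟩ => absurd h (ne_of_lt ?_)
    rw [countBelow_eq_card, countBelow_eq_card]
    refine Finset.card_lt_card (Finset.ssubset_iff_of_subset ?_ |>.2 ⟨j, ?_, ?_⟩)
    · intro x
      simp only [Finset.mem_filter]
      rintro ⟨h₁, h₂, h₃⟩
      exact ⟨h₁, by omega, h₃⟩
    · simp only [Finset.mem_filter, Finset.mem_range]
      exact ⟨by omega, hj, hjv⟩
    · simp

/-- Holds for any `d`, thanks to the greedy fallback; hence every digit string produces a feasible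
solution. -/
theorem branchVertex_notMem (hA : ∀ u v : Fin n, A (u * n + v) ≠ 0 ↔ G.Adj u v)
    {S : Finset (Fin n)} (hS : S.card < n) (d : ℕ) :
    ∃ u : Fin n, branchVertex A n (indic S) d = u ∧ u ∉ S := by
  unfold branchVertex
  split_ifs with h
  · exact ⟨⟨_, h.1⟩, rfl, indic_eq_zero.1 h.2⟩
  · obtain ⟨v, hv, hvS, -⟩ := greedyVertex_spec hA hS
    exact ⟨v, hv, hvS⟩

theorem exists_branchVertex_eq (hA : ∀ u v : Fin n, A (u * n + v) ≠ 0 ↔ G.Adj u v)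
    {S : Finset (Fin n)} {u v : Fin n} (hv : greedyVertex A n (indic S) = v)
    (hu : u ∈ G.nearby v) (huS : u ∉ S) :
    ∃ d < branchCount A n, branchVertex A n (indic S) d = u := by
  obtain ⟨d, hd, hdu⟩ := nearVertex_eq u.2 ((near_iff hA u v).2 hu)
  refine ⟨d, hd.trans_le (nearCount_le_branchCount v.2), ?_⟩
  rw [branchVertex, hv, hdu, if_pos ⟨u.2, indic_eq_zero.2 huS⟩]

/-- The partial solution after following the first `j` of the branches `d`. -/
noncomputable def branchSolution (A : ℕ → ℕ) (n : ℕ) (d : ℕ → ℕ) : ℕ → ℕ → ℕ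
  | 0 => fun _ => 0
  | j + 1 => Function.update (branchSolution A n d j)
      (branchVertex A n (branchSolution A n d j) (d j)) 1

theorem branchSolution_congr {d d' : ℕ → ℕ} {j : ℕ} (h : ∀ i < j, d i = d' i) :
    branchSolution A n d j = branchSolution A n d' j := by
  induction j with
  | zero => rfl
  | succ j ih =>
    rw [branchSolution, branchSolution, ih fun i hi => h i (by omega), h j (by omega)]

theorem branchSolution_spec (hA : ∀ u v : Fin n, A (u * n + v) ≠ 0 ↔ G.Adj u v) (d : ℕ → ℕ)
    {j : ℕ} (hj : j ≤ n) : ∃ S : Finset (Fin n), S.card = j ∧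
      branchSolution A n d j = indic S := by
  induction j with
  | zero => exact ⟨∅, rfl, indic_empty.symm⟩
  | succ j ih =>
    obtain ⟨S, hS, hd⟩ := ih (by omega)
    obtain ⟨u, hu, huS⟩ := branchVertex_notMem hA (S := S) (by omega) (d j)
    exact ⟨insert u S, by rw [Finset.card_insert_of_notMem huS, hS],
      by rw [branchSolution, hd, hu, indic_insert]⟩

theorem exists_isMaxKDominating (G : SimpleGraph (Fin n)) {k : ℕ} (hk : k ≤ n) :
    ∃ S, IsMaxKDominating G k S := by
  have hne : (Finset.powersetCard k (Finset.univ : Finset (Fin n))).Nonempty :=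
    Finset.powersetCard_nonempty.2 (by simpa using hk)
  obtain ⟨S, hS, hmax⟩ := Finset.exists_max_image _ (dominatedCount G) hne
  exact ⟨S, (Finset.mem_powersetCard.1 hS).2, fun S' h =>
    hmax S' (Finset.mem_powersetCard.2 ⟨Finset.subset_univ _, h⟩)⟩

/-- Induction on the depth, keeping the partial solution inside some optimal set. The exchange
argument may change that set at each level; at depth `k` the two coincide by cardinality. -/
theorem exists_branchSolution_optimal (hA : ∀ u v : Fin n, A (u * n + v) ≠ 0 ↔ G.Adj u v)
    {k : ℕ} (hk : k ≤ n) : ∃ d : ℕ → ℕ, (∀ i < k, d i < branchCount A n) ∧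
      ∃ S, IsMaxKDominating G k S ∧ branchSolution A n d k = indic S := by
  suffices H : ∀ j ≤ k, ∃ d : ℕ → ℕ, (∀ i < j, d i < branchCount A n) ∧
      ∃ S T, IsMaxKDominating G k S ∧ T ⊆ S ∧ T.card = j ∧ branchSolution A n d j = indic T by
    obtain ⟨d, hd, S, T, hS, hTS, hT, h⟩ := H k le_rfl
    obtain rfl : T = S := Finset.eq_of_subset_of_card_le hTS (by rw [hT, hS.1])
    exact ⟨d, hd, T, hS, h⟩
  intro j hj
  induction j with
  | zero =>
    obtain ⟨S, hS⟩ := exists_isMaxKDominating G hk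
    exact ⟨0, by simp, S, ∅, hS, by simp, rfl, indic_empty.symm⟩
  | succ j ih =>
    obtain ⟨d, hd, S, T, hS, hTS, hT, h⟩ := ih (by omega)
    obtain ⟨v, hv, hvT, hgreedy⟩ := greedyVertex_spec hA (S := T) (by omega)
    obtain ⟨S', hS', u, hu, huT, hsub⟩ :=
      SimpleGraph.exists_optimal_insert hS hTS (by omega) hvT hgreedy
    obtain ⟨b, hb, hbu⟩ := exists_branchVertex_eq hA hv hu huT
    -- The first `j` steps do not look at digit `j`, so it may be set freely.
    have hc : branchSolution A n (Function.update d j b) j = indic T := by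
      rw [← h]
      exact branchSolution_congr fun i hi => Function.update_of_ne (by omega) _ _
    refine ⟨Function.update d j b, fun i hi => ?_, S', insert u T, hS', hsub, ?_, ?_⟩
    · rw [Function.update_apply]
      split_ifs with hij
      · exact hb
      · exact hd i (by omega)
    · rw [Finset.card_insert_of_notMem huT, hT]
    · rw [branchSolution, hc, Function.update_self, hbu, indic_insert]

end Bridge

/-! ### Counting in base `D` -/

/-- The number with the digits `d 0, …, d (k - 1)` in base `D`. -/
def digitValue (D : ℕ) (d : ℕ → ℕ) (k : ℕ) : ℕ := ∑ i ∈ Finset.range k, d i * D ^ i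

section Digits

variable {D k : ℕ} {d d' : ℕ → ℕ}

theorem digitValue_lt (h : ∀ i < k, d i < D) : digitValue D d k < D ^ k := by
  induction k with
  | zero => simp [digitValue]
  | succ k ih =>
    have h₁ := ih fun i hi => h i (by omega)
    have h₂ : (d k + 1) * D ^ k ≤ D * D ^ k := Nat.mul_le_mul_right _ (h k (by omega))
    rw [digitValue, Finset.sum_range_succ, ← digitValue, pow_succ']
    rw [add_mul] at h₂
    omega

/-- Identifies any legal string of value `j` with the one tried when the counter stands at `j`. -/
theorem digitValue_inj (h : ∀ i < k, d i < D) (h' : ∀ i < k, d' i < D)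
    (he : digitValue D d k = digitValue D d' k) : ∀ i < k, d i = d' i := by
  induction k with
  | zero => simp
  | succ k ih =>
    have h₁ := digitValue_lt fun i (hi : i < k) => h i (by omega)
    have h₂ := digitValue_lt fun i (hi : i < k) => h' i (by omega)
    have hpos : 0 < D ^ k := by omega
    rw [digitValue, digitValue, Finset.sum_range_succ, Finset.sum_range_succ, ← digitValue,
      ← digitValue] at he
    have hk : d k = d' k := by
      have := congrArg (· / D ^ k) he
      simpa [Nat.add_mul_div_right _ _ hpos, Nat.div_eq_of_lt h₁, Nat.div_eq_of_lt h₂] using this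
    rw [hk] at he
    intro i hi
    rcases Nat.lt_succ_iff_lt_or_eq.1 hi with hi | rfl
    · exact ih (fun i hi => h i (by omega)) (fun i hi => h' i (by omega)) (by omega) i hi
    · exact hk

theorem digitValue_add_one_of_full {q : ℕ} (h : ∀ i < q, d i + 1 = D) :
    digitValue D d q + 1 = D ^ q := by
  induction q with
  | zero => simp [digitValue]
  | succ q ih =>
    have h₁ := ih fun i hi => h i (by omega)
    rw [digitValue, Finset.sum_range_succ, ← digitValue, pow_succ', ← h q (by omega), add_mul,
      one_mul, h q (by omega)]
    omega

/-- Resetting `q` full digits loses `D^q - 1`, while raising digit `q` gains `D^q`. -/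
theorem digitValue_carry {q : ℕ} (hq : q < k) (hlt : ∀ i < q, d i + 1 = D)
    (h0 : ∀ i < q, d' i = 0) (h1 : d' q = d q + 1) (h : ∀ i, q < i → i < k → d' i = d i) :
    digitValue D d' k = digitValue D d k + 1 := by
  induction k, hq using Nat.le_induction with
  | base =>
    rw [digitValue, digitValue, Finset.sum_range_succ, Finset.sum_range_succ, h1,
      ← digitValue, ← digitValue, add_mul, one_mul, ← digitValue_add_one_of_full hlt]
    have : digitValue D d' q = 0 :=
      Finset.sum_eq_zero fun i hi => by rw [h0 i (Finset.mem_range.1 hi), zero_mul]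
    omega
  | succ k hk ih =>
    have := ih fun i h₁ h₂ => h i h₁ (by omega)
    rw [digitValue, digitValue, Finset.sum_range_succ, Finset.sum_range_succ, h k hk (by omega),
      ← digitValue, ← digitValue, this]
    omega

/-- When all `k` digits are full, the search is stopped by `j = k` if `k < n`, and by its default
value `n` if `k = n`; either way it returns `k`. -/
theorem carryPosition_spec {n : ℕ} (hk : k ≤ n) :
    carryPosition n k D d ≤ k ∧ (∀ i < carryPosition n k D d, d i + 1 = D) ∧
      (carryPosition n k D d < k → d (carryPosition n k D d) + 1 ≠ D) := by
  by_cases h : ∃ j < n, k ≤ j ∨ d j + 1 ≠ D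
  · obtain ⟨h₁, h₂, h₃⟩ := firstBelow_spec h
    refine ⟨?_, fun i hi => ?_, fun h => ?_⟩
    · by_contra! hlt
      exact h₃ k hlt (.inl le_rfl)
    · have := h₃ i hi
      push Not at this
      exact this.2
    · exact h₂.resolve_left (by unfold carryPosition at h; omega)
  · push Not at h
    have hq : carryPosition n k D d = n :=
      firstBelow_of_forall_not fun i hi => by push Not; exact h i hi
    rw [hq]
    rcases hk.eq_or_lt with rfl | hk
    · exact ⟨le_rfl, fun i hi => (h i hi).2, fun h => absurd h (lt_irrefl _)⟩
    · exact absurd (h k hk).1 (lt_irrefl _)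

end Digits

/-! ### Correctness of the program -/

namespace Mem

variable {n k : ℕ} {G : SimpleGraph (Fin n)} {A : ℕ → ℕ}

/-- The memory after `j` rounds. -/
structure Invariant (G : SimpleGraph (Fin n)) (A : ℕ → ℕ) (k j : ℕ) (a : Mem) : Prop where
  n_eq : a.n = n
  k_eq : a.k = k
  D_eq : a.D = branchCount A n
  A_eq : a.A = A
  run_eq : a.run = ind (j < branchCount A n ^ k)
  T_eq : ∀ i, n ≤ i → a.T i = 0
  dig_lt : j < branchCount A n ^ k → ∀ i < k, a.dig i < branchCount A n
  dig_eq : j < branchCount A n ^ k → digitValue (branchCount A n) a.dig k = j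
  le_best : ∀ d : ℕ → ℕ, (∀ i < k, d i < branchCount A n) →
    digitValue (branchCount A n) d k < j → solutionValue A n (branchSolution A n d k) ≤ a.best
  B_eq : 0 < j → ∃ S : Finset (Fin n), S.card = k ∧ a.best = dominatedCount G S ∧
    ∀ v : Fin n, a.B v = indic S v
  best_eq : j = 0 → a.best = 0

theorem build_eq (a : Mem) (hT : a.T = fun _ => 0) (hk : a.k ≤ a.n) :
    a.build = { a with T := branchSolution a.A a.n a.dig a.k } := by
  suffices H : ∀ N, loopN extend a N =
      { a with T := branchSolution a.A a.n a.dig (min N a.k) } by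
    rw [build, H, min_eq_right hk]
  intro N
  induction N with
  | zero => simp only [loopN, zero_min, branchSolution, ← hT]
  | succ N ih =>
    rw [loopN, ih, extend]
    split_ifs with h
    · simp only at h
      rw [min_eq_left (by omega), min_eq_left (by omega)]
      rfl
    · simp only at h
      rw [min_eq_right (by omega), min_eq_right (by omega)]

theorem next_eq (a : Mem) : a.next = { a with
    run := ind (carryPosition a.n a.k a.D a.dig < a.k)
    dig := (fun i => if i < a.n then
      (if i < carryPosition a.n a.k a.D a.dig then 0
        else if i = carryPosition a.n a.k a.D a.dig then a.dig i + 1 else a.dig i)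
      else a.dig i) } := by
  rw [next, bump_eq]

variable [DecidableRel G.Adj]

/-- Carry position `k` means that all digits are full and `j + 1 = D^k`, so the enumeration is over.
A smaller position gives an ordinary increment. -/
theorem Invariant.next_digits {a : Mem} {D j : ℕ} (hk : a.k ≤ a.n)
    (hlt : ∀ i < a.k, a.dig i < a.D) (hj : digitValue a.D a.dig a.k = j) (hD : a.D = D) :
    a.next.run = ind (j + 1 < D ^ a.k) ∧ (j + 1 < D ^ a.k →
      (∀ i < a.k, a.next.dig i < D) ∧ digitValue D a.next.dig a.k = j + 1) := by
  subst hD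
  obtain ⟨hq, hfull, hne⟩ := carryPosition_spec (D := a.D) (d := a.dig) hk
  rw [next_eq]
  set q := carryPosition a.n a.k a.D a.dig with hqdef
  clear_value q
  rcases hq.eq_or_lt with rfl | hq
  · have := digitValue_add_one_of_full hfull
    have h : ¬ j + 1 < a.D ^ a.k := by omega
    exact ⟨by rw [ind_of_not h, ind_of_not (lt_irrefl _)], fun h' => absurd h' h⟩
  · have hdig : ∀ i < a.k, (if i < a.n then
        (if i < q then 0 else if i = q then a.dig i + 1 else a.dig i) else a.dig i) < a.D := by
      intro i hi
      have := hlt i hi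
      split_ifs with h₁ h₂ h₃
      · omega
      · subst h₃
        have := hne hq
        omega
      · exact this
      · exact this
    have hval := digitValue_carry (d' := fun i => if i < a.n then
        (if i < q then 0 else if i = q then a.dig i + 1 else a.dig i) else a.dig i) hq hfull
      (fun i hi => by rw [if_pos (by omega), if_pos hi])
      (by rw [if_pos (by omega), if_neg (lt_irrefl _), if_pos rfl])
      (fun i h₁ h₂ => by rw [if_pos (by omega), if_neg (by omega), if_neg (by omega)])
    rw [hj] at hval
    -- The new digits are all legal, so their value `j + 1` is below `D^k`, which justifies keeping
    -- the flag set.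
    have := digitValue_lt hdig
    have h : j + 1 < a.D ^ a.k := by omega
    exact ⟨by rw [ind_of h, ind_of hq], fun _ => ⟨hdig, hval⟩⟩

theorem Invariant.start (hA : ∀ u v : Fin n, A (u * n + v) ≠ 0 ↔ G.Adj u v) (hk : k ≤ n)
    {a : Mem} (hn : a.n = n) (hk' : a.k = k) (hA' : a.A = A) (hbest : a.best = 0)
    (hT : a.T = fun _ => 0) (hdig : a.dig = fun _ => 0) : Invariant G A k 0 a.start := by
  -- For `k = 0` positivity of `D` may fail (when `n = 0`), but then `D^k = 1` and the single empty
  -- string is still tried.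
  have hD : 0 < k → 0 < branchCount A n := fun h => branchCount_pos hA (by omega)
  have hpow : 0 < branchCount A n ^ k := by
    rcases Nat.eq_zero_or_pos k with rfl | h
    · simp
    · exact pow_pos (hD h) k
  refine ⟨hn, hk', by simp [Mem.start, hn, hA'], hA', (ind_of hpow).symm,
    fun _ _ => congrFun hT _, ?_, ?_, by simp, by simp, fun _ => hbest⟩
  · intro _ i hi
    simpa [Mem.start, hdig] using hD (by omega)
  · intro _
    simp [Mem.start, hdig, digitValue]

theorem Invariant.round (hA : ∀ u v : Fin n, A (u * n + v) ≠ 0 ↔ G.Adj u v) (hk : k ≤ n)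
    {j : ℕ} (hj : j < branchCount A n ^ k) {a : Mem} (h : Invariant G A k j a) :
    Invariant G A k (j + 1) a.round := by
  obtain ⟨hn, hk', hD, hA', -, hT, hlt, hval, hle, hB, h0⟩ := h
  specialize hlt hj
  specialize hval hj
  obtain ⟨S, hS, hSd⟩ := branchSolution_spec hA a.dig hk
  -- `clear` resets only the cells below `n`; the invariant that `T` vanishes beyond them makes the
  -- cleared array the zero function.
  have hbuild : a.clear.build = { a with T := indic S } := by
    rw [clear_eq, build_eq _ _ (by simpa [hk', hn] using hk)]
    · simp only [hk', hn, hA', hSd]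
    · funext i
      simp only
      split_ifs with hi
      · rfl
      · exact hT i (by omega)
  have hrec : ∃ b B, a.clear.build.record = { a with T := indic S, best := b, B := B } ∧
      a.best ≤ b ∧ dominatedCount G S ≤ b ∧
      ∃ S' : Finset (Fin n), S'.card = k ∧ b = dominatedCount G S' ∧
        ∀ v : Fin n, B v = indic S' v := by
    rw [hbuild, record_eq]
    simp only [hA', hn, solutionValue_eq hA]
    split_ifs with hb
    · exact ⟨_, _, rfl, hb, le_rfl, S, hS, rfl, fun v => if_pos v.2⟩
    -- In round 0 the best value is 0 and the comparison is non-strict, so a solution is always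
    -- recorded there; rejection forces `j > 0`.
    · refine ⟨_, _, rfl, le_rfl, by omega, hB ?_⟩
      rcases Nat.eq_zero_or_pos j with hj0 | hj0
      · have := h0 hj0
        omega
      · exact hj0
  obtain ⟨b, B, hrec, hb, hbS, hS'⟩ := hrec
  obtain ⟨hrun, hnext⟩ := Invariant.next_digits (a := a.clear.build.record) (j := j)
    (D := branchCount A n)
    (by rw [hrec]; simpa [hk', hn] using hk) (by rw [hrec]; simpa only [hk', hD] using hlt)
    (by rw [hrec]; simpa only [hk', hD] using hval) (by rw [hrec]; exact hD)
  have hk'' : a.clear.build.record.k = k := by rw [hrec]; exact hk'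
  rw [hk''] at hrun hnext
  refine ⟨?_, ?_, ?_, ?_, hrun, ?_, fun h => (hnext h).1, fun h => (hnext h).2, ?_, fun _ => ?_,
    by omega⟩
  · rw [Mem.round, next_eq, hrec]; exact hn
  · rw [Mem.round, next_eq, hrec]; exact hk'
  · rw [Mem.round, next_eq, hrec]; exact hD
  · rw [Mem.round, next_eq, hrec]; exact hA'
  · intro i hi
    rw [Mem.round, next_eq, hrec]
    exact ind_of_not fun ⟨h, _⟩ => by omega
  · intro d hd hdj
    rw [Mem.round, next_eq, hrec]
    rcases Nat.lt_succ_iff_lt_or_eq.1 hdj with hdj | hdj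
    · exact (hle d hd hdj).trans hb
    · rw [branchSolution_congr (digitValue_inj hd hlt (by rw [hdj, hval])), hSd,
        solutionValue_eq hA]
      exact hbS
  · rw [Mem.round, next_eq, hrec]
    exact hS'

/-- Some legal string leads to an optimal set, and its value is below `D^k`. So it has been tried
and the recorded value is at least the optimum. -/
theorem Invariant.output (hA : ∀ u v : Fin n, A (u * n + v) ≠ 0 ↔ G.Adj u v) (hk : k ≤ n)
    {j : ℕ} (hj : branchCount A n ^ k = j) (hpos : 0 < j) {a : Mem} (h : Invariant G A k j a) :
    ∃ S : Finset (Fin n), IsMaxKDominating G k S ∧ (∀ v : Fin n, a.B v = indic S v) ∧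
      a.best = dominatedCount G S := by
  obtain ⟨S, hS, hbest, hB⟩ := h.B_eq hpos
  obtain ⟨d, hd, S₀, hS₀, hd₀⟩ := exists_branchSolution_optimal hA hk
  have := h.le_best d hd (hj ▸ digitValue_lt hd)
  rw [hd₀, solutionValue_eq hA, hbest] at this
  exact ⟨S, ⟨hS, fun S' hS' => (hS₀.2 S' hS').trans this⟩, hB, hbest⟩

end Mem

theorem mainTheorem11 :
    ∃ (p : RAMProgram) (P : Polynomial ℕ),
      ∀ (n : ℕ) (G : SimpleGraph (Fin n)) [DecidableRel G.Adj] (k : ℕ),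
        ∃ (t : ℕ) (s : RAMState),
          p.Runs (maxKDominatingInput G k) t s ∧
          MaxKDominatingOutput G k s ∧
          t ≤ P.eval n * max 1 ((G.maxDegree * k) ^ (2 * k)) := by
  obtain ⟨p, P, hp⟩ := Mem.cmd_start
  obtain ⟨q, Q, hq⟩ := Mem.cmd_round
  -- Register 2 first holds `k - n`, nonzero exactly in the infeasible case; otherwise it is 0 and
  -- is reused for `D`. At the end array 1 already holds the best set, and its value is copied from
  -- register 3.
  refine ⟨.seq (.sub 2 1 0) (.cond 2 (.const 0 0)
    (.seq p (.seq (.loop 4 q) (.seq (.copy 1 3) (.const 0 1))))), P + 2 * (Q + 1) + 5, ?_⟩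
  intro n G _ k
  set X := max 1 ((G.maxDegree * k) ^ (2 * k)) with hX
  have hX1 : 1 ≤ X := le_max_left _ _
  have hP : (P + 2 * (Q + 1) + 5).eval n = P.eval n + 2 * (Q.eval n + 1) + 5 := by simp
  rw [hP]
  set s₀ := maxKDominatingInput G k
  have hs₀ : s₀.reg 1 - s₀.reg 0 = k - n := rfl
  have hsub := RAMProgram.Runs.sub 2 1 0 s₀
  rw [hs₀] at hsub
  by_cases hk : n < k
  · refine ⟨_, _, .seq hsub (.cond_true ?_ (.const 0 0 _)), .inl ⟨hk, ?_⟩, ?_⟩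
    · rw [RAMState.setReg_reg_self]; omega
    · rw [RAMState.setReg_reg_self]
    · calc 1 + (1 + 1) ≤ (P.eval n + 2 * (Q.eval n + 1) + 5) * 1 := by omega
        _ ≤ _ := Nat.mul_le_mul_left _ hX1
  replace hk : k ≤ n := by omega
  set A := s₀.arr 0 with hAdef
  have hA : ∀ u v : Fin n, A (u * n + v) ≠ 0 ↔ G.Adj u v := by
    intro u v
    have : A (u * n + v) = ind (∃ u' v' : Fin n, G.Adj u' v' ∧
        (u : ℕ) * n + v = (u' : ℕ) * n + v') := by
      simp [hAdef, s₀, maxKDominatingInput, ind]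
    rw [this, Ne, ind_eq_zero, not_not]
    constructor
    · rintro ⟨u', v', h, he⟩
      have hn : 0 < n := u.pos
      have h₁ : (u : ℕ) = u' := by
        have := congrArg (· / n) he
        simpa only [add_comm (_ * n), Nat.add_mul_div_right _ _ hn, Nat.div_eq_of_lt (Fin.is_lt _),
          zero_add] using this
      have h₂ : (v : ℕ) = v' := by rw [h₁] at he; omega
      rwa [Fin.ext h₁, Fin.ext h₂]
    · exact fun h => ⟨u, v, h, rfl⟩
  set a₀ : Mem := ⟨n, k, 0, 0, 0, A, fun _ => 0, fun _ => 0, fun _ => 0⟩ with ha₀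
  have hh₀ : memCtx.Holds a₀ (s₀.setReg 2 (k - n)) := by
    refine ⟨rfl, rfl, ?_, rfl, rfl, rfl, ?_, ?_, ?_⟩
    · rw [RAMState.setReg_reg_self, Nat.sub_eq_zero_of_le hk]
    all_goals
      funext i
      simp [s₀, maxKDominatingInput, RAMState.setReg, ha₀]
  obtain ⟨t₁, s₁, hr₁, ht₁, hs₁, -⟩ := hp a₀ _ hh₀
  have hinv₀ : Mem.Invariant G A k 0 a₀.start :=
    Mem.Invariant.start hA hk rfl rfl rfl rfl rfl rfl
  -- The number `D^k` of rounds is not polynomial in `n`, so this loop lies outside `Cmd` and is run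
  -- with the invariant directly.
  obtain ⟨t₂, s₂, hr₂, ht₂, a, hs₂, hinv⟩ := RAMProgram.Runs.loop_of_invariant
    (r := 4) (p := q) (b := Q.eval n) (N := branchCount A n ^ k)
    (I := fun j s => ∃ a, memCtx.Holds a s ∧ Mem.Invariant G A k j a)
    (by
      rintro j s hj ⟨a, ha, h⟩
      have : s.reg 4 = a.run := ha.2.2.2.2.1
      rw [this, h.run_eq, ind_eq_zero]
      omega)
    (by
      rintro j hj s ⟨a, ha, h⟩
      obtain ⟨t, s', hr, ht, hs', -⟩ := hq a s ha
      have hn : memCtx.size a = n := h.n_eq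
      rw [hn] at ht
      exact ⟨t, s', hr, ht, _, hs', h.round hA hk hj⟩)
    ⟨_, hs₁, hinv₀⟩
  have hpos : 0 < branchCount A n ^ k := by
    by_contra! h
    have := hinv₀.run_eq
    rw [ind_of_not (by omega)] at this
    exact one_ne_zero this
  obtain ⟨S, hS, hB, hbest⟩ := hinv.output hA hk rfl hpos
  refine ⟨_, _, .seq hsub (.cond_false ?_ (.seq hr₁ (.seq hr₂ (.seq (.copy 1 3 _)
    (.const 0 1 _))))), .inr ⟨hk, ?_, S, hS, fun v => ?_, ?_⟩, ?_⟩
  · rw [RAMState.setReg_reg_self]; omega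
  · rw [RAMState.setReg_reg_self]
  · have h1 : s₂.arr 1 = a.B := hs₂.2.2.2.2.2.2.1
    rw [RAMState.setReg_arr, RAMState.setReg_arr, h1, hB]
    simp [indic, ind]
  · rw [RAMState.setReg_reg_of_ne _ _ (by omega), RAMState.setReg_reg_self, ← hbest]
    exact hs₂.2.2.2.1
  · have hN : branchCount A n ^ k ≤ 2 * X :=
      (Nat.pow_le_pow_left (branchCount_le hA) k).trans (sq_add_one_pow_le _ _)
    have ht₁' : t₁ ≤ P.eval n := ht₁
    have e₁ : branchCount A n ^ k * (Q.eval n + 1) ≤ 2 * X * (Q.eval n + 1) :=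
      Nat.mul_le_mul_right _ hN
    have e₂ : P.eval n ≤ P.eval n * X := Nat.le_mul_of_pos_right _ hX1
    -- The constant 5 collects the subtraction, the test of `k - n`, the final test of the main loop
    -- and the two closing instructions.
    calc 1 + (1 + (t₁ + (t₂ + (1 + 1))))
        ≤ P.eval n * X + 2 * X * (Q.eval n + 1) + 5 * X := by omega
      _ = _ := by ring
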